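/- Let $\mathscr U=\bigcup_{n\ge 0}(\mathbb N^*)^n$ be the set of finite sequences of positive integers. A marked tree is a pair $T=(\mathbf t,(\eta_u)_{u\in\mathbf t})$, where $\mathbf t\subset\mathscr U$ contains the empty sequence and the parent $u$ of each of its elements $uj$, and where for every $u\in\mathbf t$ there is an integer $k_u(\mathbf t)\ge 0$ with $ui\in\mathbf t\iff i\le k_u(\mathbf t)$; the marks $\eta_u$ lie in $\{0,1\}$. The restriction $r_h^*(T)$ keeps the nodes $u\in\mathbf t$ with $|u|\le h$ and the marks of the nodes with $|u|\le h-1$ (the nodes at level $h$ become unmarked). Let $\mathscr F_n$ be the $\sigma$-field generated by $r_n^*$ and $\mathscr F=\bigvee_n\mathscr F_n$. Let $Z_n$ be the number of nodes at level $n$ and $M_n$ the number of marked nodes at levels at most $n-1$ (so $M_0=0$). Let $\mathbf p$ be a probability distribution on $\mathbb N$ and $\mathbf q:\mathbb N\to[0,1]$, and put $\mathbf p_0(k,1)=\mathbf p(k)\mathbf q(k)$, $\mathbf p_0(k,0)=\mathbf p(k)(1-\mathbf q(k))$. Let $\mathbb P$ be the law of the marked Galton--Watson tree with marking-reproduction law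 $\mathbf p_0$, that is, the unique probability measure on $\mathscr F$ such that $\mathbb P(r_h^*=r_h^*(T))=\prod_{u\in\mathbf t,\,|u|\le h-1}\mathbf p_0(k_u(\mathbf t),\eta_u)$ for every $h\ge1$ and every marked tree $T$. Let $\mathbb E$ be the expectation under $\mathbb P$, and let $H_\ell(x)=\frac1{\ell!}\prod_{j=0}^{\ell-1}(x-j)$, with $H_0=1$. Theorem. Let $\ell\in\mathbb N$ and $t\in(0,1]$. Assume that $\mathbf p(0)+\mathbf p(1)<1$, that $\mathbf p$ has a finite mean and a finite moment of order $\ell$, that $\mathbf p(k)\mathbf q(k)>0$ for some $k$, that the set $\{j\ge 0:\mathbf p_0(j,0)>0\}$ is non-empty, and that its minimum $\tilde r$ satisfies $\tilde r\ge1$. Put $$B_n=\begin{cases}\mathbf p_0(1,0)^{-n}\,\mathbf 1_{\{M_n=0,\,Z_n=1\}}&\text{if }\tilde r=1,\\ \mathbf p_0(\tilde r,0)^{-\frac{\tilde r^n-1}{\tilde r-1}}\,\mathbf 1_{\{M_n=0,\,Z_n=\tilde r^n\}}&\text{if }\tilde r>1.\end{cases}$$ (1) If $\tilde r=1$ and $\ell\ge2$,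 assume moreover that $\mathbf p_0(j,0)>0$ for some $j\ge2$. Then for every $n\in\mathbb N$ and $\Lambda_n\in\mathscr F_n$, the number $\mathbb E[H_\ell(Z_{n+p})\mathbf 1_{\{M_{n+p}=0\}}t^{Z_{n+p}}]$ is positive for all large $p$, and $$\lim_{p\to+\infty}\frac{\mathbb E\left[\mathbf 1_{\Lambda_n}H_\ell(Z_{n+p})\mathbf 1_{\{M_{n+p}=0\}}t^{Z_{n+p}}\right]}{\mathbb E\left[H_\ell(Z_{n+p})\mathbf 1_{\{M_{n+p}=0\}}t^{Z_{n+p}}\right]}=\mathbb E\left[\mathbf 1_{\Lambda_n}B_n\right].$$ (2) $(B_n)_{n\ge0}$ is a nonnegative $(\mathscr F_n)$-martingale under $\mathbb P$ with $B_0=1$. (3) There is exactly one measure $\mathbb Q$ on $\mathscr F$ with $\mathbb Q(\Lambda_n)=\mathbb E[\mathbf 1_{\Lambda_n}B_n]$ for all $n\in\mathbb N$ and $\Lambda_n\in\mathscr F_n$, and it is the Dirac mass at the infinite regular $\tilde r$-ary tree without marks. -/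

import Mathlib

open MeasureTheory ProbabilityTheory Filter Topology
open scoped ENNReal

namespace MarkedGW

/-- Finite sequences of positive integers. The child number `i` of `u` is `u ++ [i]`. -/
abbrev Node := List ℕ+

/-- A marked tree: an ordered rooted locally finite tree in Neveu's formalism, together with
the set of its marked nodes (the nodes `u` with `η_u = 1`). -/
@[ext]
structure MarkedTree where
  nodes : Set Node
  marked : Set Node
  root_mem : [] ∈ nodes
  parent_mem : ∀ (u : Node) (j : ℕ+), u ++ [j] ∈ nodes → u ∈ nodes
  exists_children : ∀ u ∈ nodes, ∃ k : ℕ, ∀ i : ℕ+, u ++ [i] ∈ nodes ↔ (i : ℕ) ≤ k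
  marked_subset : marked ⊆ nodes

namespace MarkedTree

/-- The number `k_u` of offspring of the node `u`. -/
noncomputable def numChildren (T : MarkedTree) (u : Node) : ℕ := {i : ℕ+ | u ++ [i] ∈ T.nodes}.ncard

open Classical in
/-- The mark `η_u` of the node `u`. -/
noncomputable def mark (T : MarkedTree) (u : Node) : Bool := decide (u ∈ T.marked)

/-- The restriction `r_h^*`: keep the nodes up to generation `h` and the marks up to
generation `h - 1`. -/
def restrict (h : ℕ) (T : MarkedTree) : MarkedTree where
  nodes := {u | u ∈ T.nodes ∧ u.length ≤ h}
  marked := {u | u ∈ T.marked ∧ u.length < h}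
  root_mem := ⟨T.root_mem, Nat.zero_le _⟩
  parent_mem := by
    rintro u j ⟨hu, hl⟩
    refine ⟨T.parent_mem u j hu, ?_⟩
    simp only [List.length_append, List.length_cons, List.length_nil] at hl
    omega
  exists_children := by
    rintro u ⟨hu, hl⟩
    obtain ⟨k, hk⟩ := T.exists_children u hu
    by_cases h' : u.length < h
    · refine ⟨k, fun i => ⟨fun hi => (hk i).1 hi.1, fun hi => ⟨(hk i).2 hi, ?_⟩⟩⟩
      simp only [List.length_append, List.length_cons, List.length_nil]
      omega
    · refine ⟨0, fun i => ⟨fun hi => ?_, fun hi => ?_⟩⟩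
      · have := hi.2
        simp only [List.length_append, List.length_cons, List.length_nil] at this
        omega
      · exact absurd hi (by have := i.pos; omega)
  marked_subset := fun _ hu => ⟨T.marked_subset hu.1, hu.2.le⟩

/-- The size `Z_n` of generation `n`. -/
noncomputable def Z (n : ℕ) (T : MarkedTree) : ℕ := {u | u ∈ T.nodes ∧ u.length = n}.ncard

/-- The number `M_n` of marked nodes up to generation `n - 1`. -/
noncomputable def M (n : ℕ) (T : MarkedTree) : ℕ := {u | u ∈ T.marked ∧ u.length < n}.ncard

/-- The unmarked regular `r`-ary tree. -/
def regular (r : ℕ) : MarkedTree where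
  nodes := {u | ∀ i ∈ u, (i : ℕ) ≤ r}
  marked := ∅
  root_mem := by simp
  parent_mem := fun u j h i hi => h i (by simp [hi])
  exists_children := fun u hu => ⟨r, fun i => ⟨fun h => h i (by simp), fun h j hj => by
    rcases List.mem_append.1 hj with hj | hj
    · exact hu j hj
    · rw [List.mem_singleton.1 hj]; exact h⟩⟩
  marked_subset := Set.empty_subset _

/-- The tree in which a node `u` has `(ω u).1` children and is marked if and only if
`(ω u).2 = true`; the values of `ω` at the sequences that are not nodes play no role. -/
def ofData (ω : Node → ℕ × Bool) : MarkedTree where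
  nodes := {u | ∀ (v : Node) (j : ℕ+), v ++ [j] <+: u → (j : ℕ) ≤ (ω v).1}
  marked := {u | (∀ (v : Node) (j : ℕ+), v ++ [j] <+: u → (j : ℕ) ≤ (ω v).1) ∧ (ω u).2 = true}
  root_mem := by
    intro v j h
    simp at h
  parent_mem := fun u j h v i hv => h v i (hv.trans (List.prefix_append u [j]))
  exists_children := fun u hu => ⟨(ω u).1, fun i => ⟨fun h => h u i (List.prefix_refl _),
    fun h v j hv => by
      rcases List.prefix_concat_iff.1 hv with hv | hv
      · obtain ⟨rfl, hj⟩ := List.append_inj' hv rfl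
        rw [List.cons.injEq] at hj
        rw [hj.1]; exact h
      · exact hu v j hv⟩⟩
  marked_subset := fun _ hu => hu.1

theorem restrict_restrict {m n : ℕ} (h : m ≤ n) (T : MarkedTree) :
    (T.restrict n).restrict m = T.restrict m := by
  ext u
  · simp only [restrict, Set.mem_ofPred_eq]
    constructor
    · rintro ⟨⟨a, -⟩, b⟩; exact ⟨a, b⟩
    · rintro ⟨a, b⟩; exact ⟨⟨a, b.trans h⟩, b⟩
  · simp only [restrict, Set.mem_ofPred_eq]
    constructor
    · rintro ⟨⟨a, -⟩, b⟩; exact ⟨a, b⟩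
    · rintro ⟨a, b⟩; exact ⟨⟨a, b.trans_le h⟩, b⟩

/-- The `σ`-field `ℱ_n` generated by `r_n^*`, a map with countable range. -/
@[reducible]
def sigmaAlgebra (n : ℕ) : MeasurableSpace MarkedTree := MeasurableSpace.comap (restrict n) ⊤

/-- The `σ`-field on marked trees, generated by all the `ℱ_n`. -/
instance instMeasurableSpace : MeasurableSpace MarkedTree := ⨆ n, sigmaAlgebra n

/-- The filtration `(ℱ_n)`. -/
def filtration : Filtration ℕ instMeasurableSpace where
  seq := sigmaAlgebra
  mono' := by
    rintro m n h s ⟨A, -, rfl⟩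
    refine ⟨restrict m ⁻¹' A, trivial, ?_⟩
    ext T
    simp only [Set.mem_preimage, restrict_restrict h]
  le' := le_iSup sigmaAlgebra

end MarkedTree

/-- The marking-reproduction law `𝐩₀(k, 1) = 𝐩(k) 𝐪(k)`, `𝐩₀(k, 0) = 𝐩(k) (1 - 𝐪(k))` on `ℕ × {0, 1}`
(`true` stands for the mark `1`). -/
noncomputable def markLaw (p : PMF ℕ) (q : ℕ → unitInterval) : PMF (ℕ × Bool) :=
  ⟨fun x => p x.1 * ENNReal.ofReal (if x.2 then (q x.1 : ℝ) else 1 - (q x.1 : ℝ)), by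
    rw [Summable.hasSum_iff ENNReal.summable, ENNReal.summable.tsum_prod' fun _ => ENNReal.summable]
    have : ∀ k : ℕ, ∑' b : Bool,
        p k * ENNReal.ofReal (if b then (q k : ℝ) else 1 - (q k : ℝ)) = p k := by
      intro k
      rw [ENNReal.tsum_mul_left, tsum_fintype, Fintype.sum_bool, if_pos rfl, if_neg (by simp),
        ← ENNReal.ofReal_add (q k).2.1 (sub_nonneg.2 (q k).2.2)]
      simp
    simp only [this, p.tsum_coe]⟩

/-- The defining property of the law of the marked Galton-Watson tree with marking-reproduction law
`p₀`: for `h ≥ 1`, `P(r_h^* = r_h^*(T)) = ∏ p₀(k_u(T), η_u(T))`, the product being over the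
(finitely many) nodes `u` of `T` up to generation `h - 1`. -/
structure IsMGWLaw (p₀ : PMF (ℕ × Bool)) (P : Measure MarkedTree) : Prop where
  isProbabilityMeasure : IsProbabilityMeasure P
  apply_restrict : ∀ h : ℕ, 1 ≤ h → ∀ T : MarkedTree,
    P (MarkedTree.restrict h ⁻¹' {T.restrict h}) =
      ∏ᶠ u ∈ {u | u ∈ T.nodes ∧ u.length < h}, p₀ (T.numChildren u, T.mark u)

/-- The law of the marked Galton-Watson tree with marking-reproduction law `p₀`, built from
independent pairs (offspring number, mark) with law `p₀`. It is the unique measure that satisfies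
`IsMGWLaw p₀`, by `isMGWLaw_mgwLaw` and `IsMGWLaw.eq_mgwLaw` below. -/
noncomputable def mgwLaw (p₀ : PMF (ℕ × Bool)) : Measure MarkedTree :=
  (Measure.infinitePi fun _ : Node => p₀.toMeasure).map MarkedTree.ofData

namespace MarkedTree

theorem numChildren_eq {T : MarkedTree} {u : Node} {k : ℕ}
    (h : ∀ i : ℕ+, u ++ [i] ∈ T.nodes ↔ (i : ℕ) ≤ k) : T.numChildren u = k := by
  have : {i : ℕ+ | u ++ [i] ∈ T.nodes} = Nat.succPNat '' {j | j < k} := by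
    ext i
    rw [Set.mem_ofPred_eq, h]
    constructor
    · intro hi
      exact ⟨i.natPred, (by have := i.pos; simp only [Set.mem_ofPred_eq, PNat.natPred]; omega), PNat.succPNat_natPred i⟩
    · rintro ⟨j, hj, rfl⟩
      exact hj
  rw [numChildren, this, Set.ncard_image_of_injective _ Nat.succPNat_injective]
  have h2 : {j | j < k} = ((Finset.range k : Finset ℕ) : Set ℕ) := by
    ext j
    rw [Finset.mem_coe, Finset.mem_range, Set.mem_ofPred_eq]
  rw [h2, Set.ncard_coe_finset, Finset.card_range]

theorem child_mem_iff (T : MarkedTree) {u : Node} (hu : u ∈ T.nodes) (i : ℕ+) :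
    u ++ [i] ∈ T.nodes ↔ (i : ℕ) ≤ T.numChildren u := by
  obtain ⟨k, hk⟩ := T.exists_children u hu
  rw [numChildren_eq hk, hk]

theorem finite_level (T : MarkedTree) (n : ℕ) : {u | u ∈ T.nodes ∧ u.length = n}.Finite := by
  induction n with
  | zero =>
    refine (Set.finite_singleton ([] : Node)).subset ?_
    rintro u ⟨-, hu⟩
    exact List.length_eq_zero_iff.1 hu
  | succ n ih =>
    have hfin : ∀ u ∈ {u | u ∈ T.nodes ∧ u.length = n},
        ((fun i : ℕ+ => u ++ [i]) '' {i : ℕ+ | (i : ℕ) ≤ T.numChildren u}).Finite := by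
      intro u _
      refine Set.Finite.image _ ?_
      exact (Set.finite_le_nat (T.numChildren u)).preimage PNat.coe_injective.injOn
    refine (ih.biUnion hfin).subset ?_
    rintro u ⟨hu, hl⟩
    obtain ⟨v, i, rfl⟩ : ∃ v i, u = v ++ [i] := by
      rcases List.eq_nil_or_concat u with h | ⟨v, i, h⟩
      · simp [h] at hl
      · exact ⟨v, i, by simpa using h⟩
    have hv := T.parent_mem v i hu
    simp only [List.length_append, List.length_cons, List.length_nil] at hl
    exact Set.mem_biUnion (show v ∈ {u | u ∈ T.nodes ∧ u.length = n} from ⟨hv, by omega⟩)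
      ⟨i, (T.child_mem_iff hv i).1 hu, rfl⟩

theorem finite_lt (T : MarkedTree) (n : ℕ) : {u | u ∈ T.nodes ∧ u.length < n}.Finite := by
  refine ((Set.finite_lt_nat n).biUnion fun m _ => T.finite_level m).subset ?_
  rintro u ⟨hu, hl⟩
  exact Set.mem_biUnion (show u.length ∈ {m | m < n} from hl) ⟨hu, rfl⟩

theorem countable_range_restrict (n : ℕ) : (Set.range (restrict n)).Countable := by
  have hc : {s : Set Node | s.Finite}.Countable := Set.Countable.ofPred_finite
  have hinj : Function.Injective fun T : MarkedTree => (T.nodes, T.marked) := by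
    intro S T h
    exact MarkedTree.ext (congrArg Prod.fst h) (congrArg Prod.snd h)
  refine ((hc.prod hc).preimage_of_injOn hinj.injOn).mono ?_
  rintro _ ⟨T, rfl⟩
  have hf : (T.restrict n).nodes.Finite :=
    (T.finite_lt (n + 1)).subset fun u hu => ⟨hu.1, Nat.lt_succ_of_le hu.2⟩
  exact ⟨hf, hf.subset (T.restrict n).marked_subset⟩

theorem ofData_restrict_eq_iff (h : ℕ) (T : MarkedTree) (ω : Node → ℕ × Bool) :
    (ofData ω).restrict h = T.restrict h ↔
      ∀ u ∈ {u | u ∈ T.nodes ∧ u.length < h}, ω u = (T.numChildren u, T.mark u) := by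
  constructor
  · rintro he u ⟨hu, hl⟩
    have hn : ∀ v : Node, v.length ≤ h → (v ∈ (ofData ω).nodes ↔ v ∈ T.nodes) := by
      intro v hv
      have := congrArg (fun S : MarkedTree => v ∈ S.nodes) he
      simpa [restrict, hv] using this
    have hm : u ∈ (ofData ω).marked ↔ u ∈ T.marked := by
      have := congrArg (fun S : MarkedTree => u ∈ S.marked) he
      simpa [restrict, hl] using this
    have hu' := (hn u hl.le).2 hu
    refine Prod.ext ?_ ?_
    · refine (numChildren_eq fun i => ?_).symm
      rw [← hn _ (by simp only [List.length_append, List.length_cons, List.length_nil]; omega)]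
      refine ⟨fun hi => hi u i (List.prefix_refl _), fun hi v j hv => ?_⟩
      rcases List.prefix_concat_iff.1 hv with hv | hv
      · obtain ⟨rfl, hj⟩ := List.append_inj' hv rfl
        rw [List.cons.injEq] at hj
        rw [hj.1]; exact hi
      · exact hu' v j hv
    · have h1 : u ∈ (ofData ω).marked ↔ (ω u).2 = true := ⟨fun a => a.2, fun a => ⟨hu', a⟩⟩
      rw [Bool.eq_iff_iff, ← h1, hm]
      simp [mark]
  · intro hω
    have hn : ∀ v : Node, v.length ≤ h → (v ∈ (ofData ω).nodes ↔ v ∈ T.nodes) := by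
      intro v
      induction v using List.reverseRecOn with
      | nil => exact fun _ => iff_of_true (ofData ω).root_mem T.root_mem
      | append_singleton v i ih =>
        intro hl
        simp only [List.length_append, List.length_cons, List.length_nil] at hl
        have ih := ih (by omega)
        constructor
        · intro hi
          have hv := ih.1 ((ofData ω).parent_mem v i hi)
          rw [T.child_mem_iff hv]
          have := hi v i (List.prefix_refl _)
          rwa [hω v ⟨hv, by omega⟩] at this
        · intro hi
          have hv := T.parent_mem v i hi
          have hle := (T.child_mem_iff hv i).1 hi
          intro w j hw
          rcases List.prefix_concat_iff.1 hw with hw | hw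
          · obtain ⟨rfl, hj⟩ := List.append_inj' hw rfl
            rw [List.cons.injEq] at hj
            rw [hj.1, hω _ ⟨hv, by omega⟩]; exact hle
          · exact ih.2 hv w j hw
    refine MarkedTree.ext ?_ ?_
    · ext u
      exact and_congr_left fun hl => hn u hl
    · ext u
      refine and_congr_left fun hl => ?_
      have key : ∀ hu : u ∈ T.nodes, ((ω u).2 = true ↔ u ∈ T.marked) := by
        intro hu
        rw [hω u ⟨hu, hl⟩]
        simp [mark]
      constructor
      · intro hu
        exact (key ((hn u hl.le).1 hu.1)).1 hu.2
      · intro hu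
        have hu' := T.marked_subset hu
        exact ⟨(hn u hl.le).2 hu', (key hu').2 hu⟩

theorem preimage_restrict_eq (n : ℕ) (A : Set MarkedTree) :
    restrict n ⁻¹' A = ⋃ S ∈ A ∩ Set.range (restrict n), restrict n ⁻¹' {S} := by
  ext T
  simp

theorem ofData_preimage (h : ℕ) (T : MarkedTree) :
    ofData ⁻¹' (restrict h ⁻¹' {T.restrict h}) =
      Set.pi ((T.finite_lt h).toFinset : Set Node) fun u => {(T.numChildren u, T.mark u)} := by
  ext ω
  simp only [Set.mem_preimage, Set.mem_singleton_iff, ofData_restrict_eq_iff, Set.mem_pi,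
    Set.Finite.coe_toFinset]

theorem measurable_ofData : Measurable ofData := by
  rw [measurable_iff_comap_le]
  change MeasurableSpace.comap ofData (⨆ n, sigmaAlgebra n) ≤ _
  rw [MeasurableSpace.comap_iSup]
  refine iSup_le fun n => ?_
  rintro _ ⟨_, ⟨A, -, rfl⟩, rfl⟩
  rw [preimage_restrict_eq, Set.preimage_iUnion₂]
  refine MeasurableSet.biUnion ((countable_range_restrict n).mono Set.inter_subset_right) ?_
  rintro _ ⟨-, T, rfl⟩
  rw [ofData_preimage]
  exact MeasurableSet.pi (Finset.countable_toSet _) fun _ _ => measurableSet_singleton _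

theorem measurableSet_fiber (n : ℕ) (S : MarkedTree) : MeasurableSet (restrict n ⁻¹' {S}) :=
  filtration.le n _ ⟨{S}, trivial, rfl⟩

end MarkedTree

theorem isMGWLaw_mgwLaw (p₀ : PMF (ℕ × Bool)) : IsMGWLaw p₀ (mgwLaw p₀) where
  isProbabilityMeasure := Measure.isProbabilityMeasure_map MarkedTree.measurable_ofData.aemeasurable
  apply_restrict := by
    intro h _ T
    rw [mgwLaw, Measure.map_apply MarkedTree.measurable_ofData (MarkedTree.measurableSet_fiber _ _),
      MarkedTree.ofData_preimage, Measure.infinitePi_pi _ fun _ _ => measurableSet_singleton _,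
      finprod_mem_eq_finite_toFinset_prod _ (T.finite_lt h)]
    exact Finset.prod_congr rfl fun u _ =>
      PMF.toMeasure_apply_singleton _ _ (measurableSet_singleton _)

theorem IsMGWLaw.eq_mgwLaw {p₀ : PMF (ℕ × Bool)} {P : Measure MarkedTree} (hP : IsMGWLaw p₀ P) :
    P = mgwLaw p₀ := by
  have hQ := isMGWLaw_mgwLaw p₀
  have := hP.isProbabilityMeasure
  have := hQ.isProbabilityMeasure
  refine ext_of_generate_finite (⋃ n, {s | MeasurableSet[MarkedTree.sigmaAlgebra n] s})
    (MeasurableSpace.generateFrom_iUnion_measurableSet MarkedTree.sigmaAlgebra).symm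
    (isPiSystem_iUnion_of_monotone _
      (fun n => @MeasurableSpace.isPiSystem_measurableSet _ (MarkedTree.sigmaAlgebra n))
      (fun m n h s hs => MarkedTree.filtration.mono h s hs)) ?_ (by simp)
  intro s hs
  obtain ⟨n, hn⟩ := Set.mem_iUnion.1 hs
  obtain ⟨A, -, rfl⟩ := MarkedTree.filtration.mono (Nat.le_succ n) s hn
  rw [MarkedTree.preimage_restrict_eq]
  have hc := (MarkedTree.countable_range_restrict (n + 1)).mono (Set.inter_subset_right (s := A))
  have hd : (A ∩ Set.range (MarkedTree.restrict (n + 1))).PairwiseDisjoint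
      fun S => MarkedTree.restrict (n + 1) ⁻¹' {S} :=
    fun S _ T _ hST => (Set.disjoint_singleton.2 hST).preimage _
  rw [measure_biUnion hc hd fun S _ => MarkedTree.measurableSet_fiber _ S,
    measure_biUnion hc hd fun S _ => MarkedTree.measurableSet_fiber _ S]
  refine tsum_congr ?_
  rintro ⟨_, -, T, rfl⟩
  exact (hP.apply_restrict _ (Nat.succ_pos n) T).trans (hQ.apply_restrict _ (Nat.succ_pos n) T).symm

/-- The Hilbert polynomial `H_ℓ(x) = x (x - 1) ⋯ (x - ℓ + 1) / ℓ!`. -/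
noncomputable def hilbertPoly (ℓ : ℕ) (x : ℝ) : ℝ :=
  (1 / (ℓ.factorial : ℝ)) * ∏ j ∈ Finset.range ℓ, (x - j)

/-- The penalization `H_ℓ(Z_m) 1_{M_m = 0} t^{Z_m}`. -/
noncomputable def penalty (ℓ : ℕ) (t : ℝ) (m : ℕ) (T : MarkedTree) : ℝ :=
  hilbertPoly ℓ (T.Z m) * (if T.M m = 0 then 1 else 0) * t ^ T.Z m

/-- The limit martingale, where `a` stands for `𝐩₀(r, 0)`: `a^{-n} 1_{M_n = 0, Z_n = 1}` if `r = 1` and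
`a^{-(r^n - 1)/(r - 1)} 1_{M_n = 0, Z_n = r^n}` otherwise. -/
noncomputable def limitDensity (r : ℕ) (a : ℝ) (n : ℕ) (T : MarkedTree) : ℝ :=
  if r = 1 then (a ^ n)⁻¹ * (if T.M n = 0 ∧ T.Z n = 1 then 1 else 0)
  else a ^ (-(((r : ℝ) ^ n - 1) / ((r : ℝ) - 1))) * (if T.M n = 0 ∧ T.Z n = r ^ n then 1 else 0)

end MarkedGW

open MarkedGW

/-! Write `c j` for the mass 𝐩₀(j, 0). As long as no mark appears, the generation sizes form a
Markov chain in which each individual reproduces independently according to `c`. Since marks have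
positive probability, the total mass δ of `c` is less than 1. For F(s) = ∑ c_j s^j, the iterates f_m
= F^m(s), s ≤ 1, therefore tend to 0.

Let r ≥ 1 be the least point of the support of `c`. Without marks, generation n almost surely has at
least r^n nodes, with equality only if the tree is regular up to level n. By the Markov property
(`setLIntegral_add`), the penalized mass of an event of ℱ_n is the integral of φ_m(Z_n) over its
unmarked part, where φ_m(k) is the expected penalty m generations later, starting from k
individuals. It thus suffices that φ_m(k) is negligible with respect to φ_m(r^n), uniformly in k >
r^n up to the integrable factor k^ℓ (`exists_tendsto_zero_branchOp_iterate_choose_le`).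

The upper bound φ_m(k) ≤ k^ℓ K_m f_m^(k-1), with K_m = `momentFactor`, comes from convexity of x ↦
x^ℓ and induction on m. If r ≥ 2, then φ_m(r^n) ≥ f_m^(r^n) for large m, and K_m → 0. If r = 1, then
φ_m(1) is at least a constant times c_1^m, and K_m f_m c_1^(-m) → 0: its successive ratios are
bounded by a sequence tending to δ < 1.

Events missing the regular tree hence have limit 0 (`tendsto_penalized_zero`), and complements give
limit 1 for the others. The limit law is the Dirac mass at the regular tree. Its density on ℱ_n is
the indicator of the regular restriction divided by the probability of that restriction, which is
almost surely B_n (`setLIntegral_limitDensity`). The martingale property and the uniqueness follow.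
-/

namespace MarkedGW

/-! ### One generation of branching -/

/-- The sum over `j₁, …, j_k` of `c j₁ ⋯ c j_k * g (j₁ + ⋯ + j_k)`: the effect of one generation of
a branching process with (sub)offspring law `c` on a function `g` of the population size. -/
noncomputable def branch (c : ℕ → ℝ≥0∞) : ℕ → (ℕ → ℝ≥0∞) → ℝ≥0∞
  | 0, g => g 0
  | k + 1, g => ∑' j, c j * branch c k fun z => g (j + z)

/-- `branch` as an operator on functions of the population size. -/
noncomputable def branchOp (c : ℕ → ℝ≥0∞) (g : ℕ → ℝ≥0∞) (k : ℕ) : ℝ≥0∞ := branch c k g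

/-- The generating function of `c`, weighted by the powers `j ^ ℓ`. -/
noncomputable def momentGen (c : ℕ → ℝ≥0∞) (ℓ : ℕ) (s : ℝ≥0∞) : ℝ≥0∞ :=
  ∑' j, c j * ((j : ℝ≥0∞) ^ ℓ * s ^ j)

section Branch

variable {c : ℕ → ℝ≥0∞}

/-- If every individual has at least `r` children, only populations of size at least `k * r` are
reached. -/
theorem branch_mono_of_le {r : ℕ} (hc : ∀ j < r, c j = 0) (k : ℕ) :
    ∀ {g h : ℕ → ℝ≥0∞}, (∀ z, k * r ≤ z → g z ≤ h z) → branch c k g ≤ branch c k h := by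
  induction k with
  | zero => intro g h H; exact H 0 (by simp)
  | succ k ih =>
    intro g h H
    refine ENNReal.tsum_le_tsum fun j => ?_
    by_cases hj : j < r
    · simp [hc j hj]
    · gcongr
      refine ih fun z hz => H _ ?_
      rw [Nat.succ_mul]
      omega

theorem branch_mono (k : ℕ) {g h : ℕ → ℝ≥0∞} (H : ∀ z, g z ≤ h z) : branch c k g ≤ branch c k h :=
  branch_mono_of_le (r := 0) (by simp) k fun z _ => H z

theorem branch_const_mul (x : ℝ≥0∞) (k : ℕ) :
    ∀ g : ℕ → ℝ≥0∞, branch c k (fun z => x * g z) = x * branch c k g := by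
  induction k with
  | zero => intro g; rfl
  | succ k ih =>
    intro g
    simp only [branch, ih, ← ENNReal.tsum_mul_left]
    exact tsum_congr fun j => by ring

theorem branch_add (k : ℕ) :
    ∀ g h : ℕ → ℝ≥0∞, branch c k (fun z => g z + h z) = branch c k g + branch c k h := by
  induction k with
  | zero => intro g h; rfl
  | succ k ih =>
    intro g h
    simp only [branch, ih, ← ENNReal.tsum_add, mul_add]

theorem branch_pow (s : ℝ≥0∞) (k : ℕ) :
    branch c k (fun z => s ^ z) = momentGen c 0 s ^ k := by
  induction k with
  | zero => simp [branch]
  | succ k ih =>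
    simp only [branch, pow_add, branch_const_mul, ih]
    rw [pow_one, mul_comm, momentGen, ← ENNReal.tsum_mul_right]
    exact tsum_congr fun j => by simp [mul_assoc]

theorem pow_mul_le_branch (j k : ℕ) :
    ∀ h : ℕ → ℝ≥0∞, c j ^ k * h (k * j) ≤ branch c k h := by
  induction k with
  | zero => intro h; simp [branch]
  | succ k ih =>
    intro h
    refine le_trans ?_ (ENNReal.le_tsum j)
    rw [pow_succ', mul_assoc]
    gcongr
    refine le_trans (le_of_eq ?_) (ih _)
    rw [Nat.succ_mul, add_comm]

/-- A total of at most `k * r` forces every individual to have exactly `r` children. -/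
theorem branch_le_pow_mul {r : ℕ} (hc : ∀ j < r, c j = 0) (k : ℕ) :
    ∀ h : ℕ → ℝ≥0∞, (∀ z, k * r < z → h z = 0) → branch c k h ≤ c r ^ k * h (k * r) := by
  induction k with
  | zero => intro h _; simp [branch]
  | succ k ih =>
    intro h H
    rw [branch, tsum_eq_single r]
    · rw [pow_succ', mul_assoc]
      gcongr
      refine (ih _ fun z hz => H _ ?_).trans (le_of_eq ?_)
      · rw [Nat.succ_mul]; omega
      · rw [Nat.succ_mul, add_comm]
    · intro j hj
      rcases lt_or_gt_of_ne hj with hj | hj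
      · simp [hc j hj]
      · refine mul_eq_zero_of_right _ (le_antisymm ?_ zero_le)
        have h0 : branch c k (fun z => 0 * h (j + z)) = 0 := by
          rw [branch_const_mul, zero_mul]
        rw [← h0]
        refine branch_mono_of_le hc k fun z hz => ?_
        rw [H _ (by rw [Nat.succ_mul]; omega)]
        simp

/-- Convexity of the power at the points `j` and `z / k` with weights 1/(k+1) and k/(k+1), cleared
of denominators: one individual is added to a group of `k`. -/
theorem add_pow_mul_pow_le (k n j z : ℕ) (hk : k ≠ 0) :
    (k : ℝ≥0∞) ^ n * ((j + z : ℕ) : ℝ≥0∞) ^ (n + 1) ≤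
      ((k + 1 : ℕ) : ℝ≥0∞) ^ n * ((k : ℝ≥0∞) ^ n * (j : ℝ≥0∞) ^ (n + 1) + (z : ℝ≥0∞) ^ (n + 1)) := by
  have hk0 : (0 : ℝ) < k := by positivity
  have key := (convexOn_pow (n + 1)).2 (show (j : ℝ) ∈ Set.Ici 0 by simp)
    (show (z : ℝ) / k ∈ Set.Ici 0 by simp only [Set.mem_Ici]; positivity)
    (show (0 : ℝ) ≤ 1 / (k + 1) by positivity) (show (0 : ℝ) ≤ k / (k + 1) by positivity)
    (by field_simp; ring)
  simp only [smul_eq_mul] at key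
  have e : (1 : ℝ) / (k + 1) * j + k / (k + 1) * (z / k) = (j + z) / (k + 1) := by field_simp
  rw [e, div_pow, div_pow, div_le_iff₀ (by positivity)] at key
  have hR : (k : ℝ) ^ n * ((j : ℝ) + z) ^ (n + 1) ≤
      ((k : ℝ) + 1) ^ n * ((k : ℝ) ^ n * (j : ℝ) ^ (n + 1) + (z : ℝ) ^ (n + 1)) := by
    refine (mul_le_mul_of_nonneg_left key (by positivity)).trans (le_of_eq ?_)
    field_simp
    ring
  have hN : k ^ n * (j + z) ^ (n + 1) ≤ (k + 1) ^ n * (k ^ n * j ^ (n + 1) + z ^ (n + 1)) := by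
    exact_mod_cast hR
  exact_mod_cast hN

/-- By the power mean inequality, (j₁ + ⋯ + j_k)^ℓ ≤ k^(ℓ-1) ∑ j_i^ℓ. Each of the `k` summands
contributes one moment factor and `k - 1` plain generating functions. -/
theorem branch_natPow_mul_pow_le (ℓ : ℕ) (s : ℝ≥0∞) (k : ℕ) (hk : k ≠ 0) :
    branch c k (fun z => (z : ℝ≥0∞) ^ ℓ * s ^ z) ≤
      (k : ℝ≥0∞) ^ ℓ * (momentGen c ℓ s * momentGen c 0 s ^ (k - 1)) := by
  cases ℓ with
  | zero =>
    simp only [pow_zero, one_mul, branch_pow]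
    rw [← pow_succ', Nat.sub_add_cancel (Nat.one_le_iff_ne_zero.2 hk)]
  | succ n =>
    obtain ⟨k, rfl⟩ := Nat.exists_eq_succ_of_ne_zero hk
    clear hk
    induction k with
    | zero =>
      simp [branch, momentGen]
    | succ k ih =>
      set v := momentGen c (n + 1) s with hv
      set F := momentGen c 0 s with hF
      have hk0 : ((k + 1 : ℕ) : ℝ≥0∞) ^ n ≠ 0 := by positivity
      have hkt : ((k + 1 : ℕ) : ℝ≥0∞) ^ n ≠ ⊤ := ENNReal.pow_ne_top (ENNReal.natCast_ne_top _)
      -- Multiplying by (k+1)^n makes the division-free convexity inequality applicable.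
      rw [← ENNReal.mul_le_mul_iff_right hk0 hkt]
      rw [branch, ← ENNReal.tsum_mul_left]
      calc ∑' j, ((k + 1 : ℕ) : ℝ≥0∞) ^ n * (c j * branch c (k + 1)
              fun z => ((j + z : ℕ) : ℝ≥0∞) ^ (n + 1) * s ^ (j + z))
          ≤ ∑' j, ((k + 1 + 1 : ℕ) : ℝ≥0∞) ^ n * (((k + 1 : ℕ) : ℝ≥0∞) ^ n * F ^ (k + 1) *
              (c j * ((j : ℝ≥0∞) ^ (n + 1) * s ^ j)) +
              (((k + 1 : ℕ) : ℝ≥0∞) ^ (n + 1) * (v * F ^ k)) *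
                (c j * ((j : ℝ≥0∞) ^ 0 * s ^ j))) := by
            refine ENNReal.tsum_le_tsum fun j => ?_
            calc _ = c j * branch c (k + 1) fun z => ((k + 1 : ℕ) : ℝ≥0∞) ^ n *
                    (((j + z : ℕ) : ℝ≥0∞) ^ (n + 1) * s ^ (j + z)) := by
                  rw [branch_const_mul]; ring
              _ ≤ c j * branch c (k + 1) fun z => (((k + 1 + 1 : ℕ) : ℝ≥0∞) ^ n *
                    ((k + 1 : ℕ) : ℝ≥0∞) ^ n * (j : ℝ≥0∞) ^ (n + 1) * s ^ j) * s ^ z +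
                    (((k + 1 + 1 : ℕ) : ℝ≥0∞) ^ n * s ^ j) * ((z : ℝ≥0∞) ^ (n + 1) * s ^ z) := by
                  gcongr
                  refine branch_mono _ fun z => ?_
                  rw [← mul_assoc]
                  refine (mul_le_mul_left (add_pow_mul_pow_le (k + 1) n j z (by omega)) _).trans
                    (le_of_eq ?_)
                  rw [pow_add]
                  ring
              _ ≤ _ := by
                  rw [branch_add, branch_const_mul, branch_const_mul, branch_pow]
                  refine (mul_le_mul_right (add_le_add_right
                    (mul_le_mul_right ih _) _) _).trans (le_of_eq ?_)
                  simp only [Nat.succ_eq_add_one, Nat.add_sub_cancel, ← hF]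
                  ring
        _ = _ := by
            rw [ENNReal.tsum_mul_left, ENNReal.tsum_add, ENNReal.tsum_mul_left,
              ENNReal.tsum_mul_left]
            change _ * (_ * v + _ * F) = _
            simp only [Nat.succ_eq_add_one, Nat.add_sub_cancel]
            push_cast
            ring

end Branch

/-! ### Iterated branching and generating functions -/

section Iterate

variable {c : ℕ → ℝ≥0∞} {r : ℕ}

theorem branchOp_iterate_mono_of_le (hc : ∀ j < r, c j = 0) (k p : ℕ) :
    ∀ {g h : ℕ → ℝ≥0∞}, (∀ z, k * r ^ p ≤ z → g z ≤ h z) →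
      (branchOp c)^[p] g k ≤ (branchOp c)^[p] h k := by
  induction p with
  | zero => intro g h H; exact H k (by simp)
  | succ p ih =>
    intro g h H
    simp only [Function.iterate_succ_apply]
    refine ih fun z hz => branch_mono_of_le hc z fun y hy => H y (le_trans ?_ hy)
    rw [pow_succ, ← mul_assoc]
    exact Nat.mul_le_mul_right r hz

theorem branchOp_iterate_mono (k p : ℕ) {g h : ℕ → ℝ≥0∞} (H : ∀ z, g z ≤ h z) :
    (branchOp c)^[p] g k ≤ (branchOp c)^[p] h k :=
  branchOp_iterate_mono_of_le (r := 0) (by simp) k p fun z _ => H z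

theorem branchOp_iterate_pow (s : ℝ≥0∞) (p : ℕ) :
    (branchOp c)^[p] (fun z => s ^ z) = fun z => ((momentGen c 0)^[p] s) ^ z := by
  induction p generalizing s with
  | zero => rfl
  | succ p ih =>
    rw [Function.iterate_succ_apply, Function.iterate_succ_apply, ← ih]
    congr 1
    exact funext fun z => branch_pow s z

/-- The exponent counts the individuals that reproduce during `p` generations, starting from `k`,
when each has exactly `r` children. -/
theorem branchOp_iterate_le_pow_mul (hr : 1 ≤ r) (hc : ∀ j < r, c j = 0) (k p : ℕ) :
    ∀ h : ℕ → ℝ≥0∞, (∀ z, k * r ^ p < z → h z = 0) →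
      (branchOp c)^[p] h k ≤ c r ^ (k * ∑ i ∈ Finset.range p, r ^ i) * h (k * r ^ p) := by
  induction p with
  | zero => intro h _; simp
  | succ p ih =>
    intro h H
    have hlt : ∀ z y : ℕ, k * r ^ p < z → z * r ≤ y → k * r ^ (p + 1) < y := by
      intro z y hz hy
      refine lt_of_lt_of_le ?_ hy
      rw [pow_succ, ← mul_assoc]
      exact Nat.mul_lt_mul_of_pos_right hz hr
    rw [Function.iterate_succ_apply, Finset.sum_range_succ, mul_add, pow_add, mul_assoc]
    refine (ih _ fun z hz => le_antisymm ?_ zero_le).trans ?_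
    · have h0 : branch c z (fun y => 0 * h y) = 0 := by rw [branch_const_mul, zero_mul]
      rw [← h0]
      refine branch_mono_of_le hc z fun y hy => ?_
      rw [H y (hlt z y hz hy)]
      simp
    · gcongr
      rw [pow_succ, ← mul_assoc k]
      refine branch_le_pow_mul hc _ h fun z hz => H z ?_
      rwa [pow_succ, ← mul_assoc]

theorem branchOp_iterate_pos {j : ℕ} (hj : c j ≠ 0) (k p : ℕ) :
    ∀ h : ℕ → ℝ≥0∞, h (k * j ^ p) ≠ 0 → (branchOp c)^[p] h k ≠ 0 := by
  induction p with
  | zero => intro h H; simpa using H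
  | succ p ih =>
    intro h H
    rw [Function.iterate_succ_apply]
    refine ih _ fun h0 => ?_
    have := pow_mul_le_branch (c := c) j (k * j ^ p) h
    rw [show branch c (k * j ^ p) h = 0 from h0, mul_assoc, ← pow_succ] at this
    exact mul_ne_zero (pow_ne_zero _ hj) H (le_antisymm this zero_le)

/-- Only the paths on which the population stays equal to 1 during the first `p` generations are
kept. -/
theorem pow_mul_branchOp_iterate_le (p p₀ : ℕ) (g : ℕ → ℝ≥0∞) :
    c 1 ^ p * (branchOp c)^[p₀] g 1 ≤ (branchOp c)^[p + p₀] g 1 := by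
  induction p with
  | zero => simp
  | succ p ih =>
    rw [pow_succ', mul_assoc, Nat.succ_add, Function.iterate_succ_apply']
    refine (mul_le_mul_right ih _).trans ?_
    have := pow_mul_le_branch (c := c) 1 1 ((branchOp c)^[p + p₀] g)
    rw [pow_one, mul_one] at this
    exact this

/-- On the support of `c`, s^j ≤ s^r. The case `r = 0` bounds by the value at 1, and the case `r =
1` makes the generating function contract towards 0. -/
theorem momentGen_le_mul_pow (hc : ∀ j < r, c j = 0) (ℓ : ℕ) {s : ℝ≥0∞} (hs : s ≤ 1) :
    momentGen c ℓ s ≤ momentGen c ℓ 1 * s ^ r := by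
  simp only [momentGen, ← ENNReal.tsum_mul_right]
  refine ENNReal.tsum_le_tsum fun j => ?_
  by_cases hj : j < r
  · simp [hc j hj]
  · rw [one_pow, mul_one, ← mul_assoc]
    exact mul_le_mul_right (pow_le_pow_right_of_le_one' hs (not_lt.1 hj)) _

/-- The term `j = 1` is kept exactly, because `c 1` is the decay rate that matters when `r = 1`. -/
theorem momentGen_le_add (hc : c 0 = 0) (ℓ : ℕ) {s : ℝ≥0∞} (hs : s ≤ 1) :
    momentGen c ℓ s ≤ c 1 * s + momentGen c ℓ 1 * s ^ 2 := by
  have : c 1 * s = ∑' j, if j = 1 then c 1 * s else 0 := (tsum_ite_eq 1 fun _ => c 1 * s).symm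
  rw [this]
  simp only [momentGen, ← ENNReal.tsum_mul_right, ← ENNReal.tsum_add]
  refine ENNReal.tsum_le_tsum fun j => ?_
  rcases j with _ | _ | j
  · simp [hc]
  · simp
  · rw [one_pow, mul_one, ← mul_assoc]
    refine le_trans ?_ le_add_self
    exact mul_le_mul_right (pow_le_pow_right_of_le_one' hs (by omega)) _

theorem momentGen_iterate_le_one (hδ : momentGen c 0 1 ≤ 1) {s : ℝ≥0∞} (hs : s ≤ 1) (p : ℕ) :
    (momentGen c 0)^[p] s ≤ 1 := by
  induction p with
  | zero => exact hs
  | succ p ih =>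
    rw [Function.iterate_succ_apply']
    simpa using (momentGen_le_mul_pow (r := 0) (by simp) 0 ih).trans (by simpa using hδ)

theorem momentGen_iterate_ne_zero (hcr : c r ≠ 0) {s : ℝ≥0∞} (hs : s ≠ 0) (p : ℕ) :
    (momentGen c 0)^[p] s ≠ 0 := by
  induction p with
  | zero => exact hs
  | succ p ih =>
    rw [Function.iterate_succ_apply']
    intro h
    have := (ENNReal.tsum_eq_zero.1 h) r
    simp [hcr, ih] at this

theorem momentGen_iterate_succ_le (hc : c 0 = 0) (hδ : momentGen c 0 1 ≤ 1) {s : ℝ≥0∞}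
    (hs : s ≤ 1) (p : ℕ) :
    (momentGen c 0)^[p + 1] s ≤ momentGen c 0 1 * (momentGen c 0)^[p] s := by
  rw [Function.iterate_succ_apply']
  simpa using momentGen_le_mul_pow (r := 1) (by simpa using hc) 0
    (momentGen_iterate_le_one hδ hs p)

theorem tendsto_momentGen_iterate (hc : c 0 = 0) (hδ : momentGen c 0 1 < 1) {s : ℝ≥0∞}
    (hs : s ≤ 1) : Tendsto (fun p => (momentGen c 0)^[p] s) atTop (𝓝 0) := by
  have hle : ∀ p, (momentGen c 0)^[p] s ≤ momentGen c 0 1 ^ p := by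
    intro p
    induction p with
    | zero => simpa using hs
    | succ p ih =>
      refine (momentGen_iterate_succ_le hc hδ.le hs p).trans ?_
      rw [pow_succ']
      gcongr
  exact tendsto_of_tendsto_of_tendsto_of_le_of_le tendsto_const_nhds
    (ENNReal.tendsto_pow_atTop_nhds_zero_of_lt_one hδ) (fun _ => zero_le) hle

/-! ### Moments along the iterates, and negligibility of larger populations -/

/-- The growth rate of the moments of order `ℓ` along the iterates of the generating function. -/
noncomputable def momentFactor (c : ℕ → ℝ≥0∞) (ℓ : ℕ) (s : ℝ≥0∞) (p : ℕ) : ℝ≥0∞ :=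
  s * ∏ i ∈ Finset.range p, ((momentGen c 0)^[i] s)⁻¹ * momentGen c ℓ ((momentGen c 0)^[i] s)

theorem momentFactor_succ (ℓ : ℕ) (s : ℝ≥0∞) (p : ℕ) :
    momentFactor c ℓ s (p + 1) = momentFactor c ℓ s p *
      (((momentGen c 0)^[p] s)⁻¹ * momentGen c ℓ ((momentGen c 0)^[p] s)) := by
  rw [momentFactor, Finset.prod_range_succ, ← mul_assoc]
  rfl

theorem momentFactor_ne_top (ℓ : ℕ) (hcr : c r ≠ 0) (hδ : momentGen c 0 1 ≤ 1)
    (hA : momentGen c ℓ 1 ≠ ⊤) {s : ℝ≥0∞} (hs : s ≤ 1) (hs0 : s ≠ 0) (p : ℕ) :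
    momentFactor c ℓ s p ≠ ⊤ := by
  refine ENNReal.mul_ne_top (ne_top_of_le_ne_top ENNReal.one_ne_top hs)
    (ENNReal.prod_ne_top fun i _ => ENNReal.mul_ne_top
      (ENNReal.inv_ne_top.2 (momentGen_iterate_ne_zero hcr hs0 i)) ?_)
  refine ne_top_of_le_ne_top hA ?_
  simpa using momentGen_le_mul_pow (r := 0) (by simp) ℓ (momentGen_iterate_le_one hδ hs i)

/-- The bound reproduces itself: k^ℓ f^(k-1) equals f⁻¹ k^ℓ f^k for `k ≥ 1`, and one more generation
applied to k^ℓ f^k is controlled by `branch_natPow_mul_pow_le`. This is the origin of the inverses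
in `momentFactor`. -/
theorem branchOp_iterate_natPow_mul_pow_le (hr : 1 ≤ r) (hc : ∀ j < r, c j = 0) (hcr : c r ≠ 0)
    (hδ : momentGen c 0 1 ≤ 1) (ℓ : ℕ) {s : ℝ≥0∞} (hs : s ≤ 1) (hs0 : s ≠ 0) (p k : ℕ)
    (hk : k ≠ 0) :
    (branchOp c)^[p] (fun z => (z : ℝ≥0∞) ^ ℓ * s ^ z) k ≤
      (k : ℝ≥0∞) ^ ℓ * (momentFactor c ℓ s p * ((momentGen c 0)^[p] s) ^ (k - 1)) := by
  induction p generalizing k with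
  | zero =>
    simp only [Function.iterate_zero, id, momentFactor, Finset.range_zero, Finset.prod_empty,
      mul_one]
    rw [← pow_succ', Nat.sub_add_cancel (Nat.one_le_iff_ne_zero.2 hk)]
  | succ p ih =>
    rw [Function.iterate_succ_apply', Function.iterate_succ_apply', momentFactor_succ]
    set f := (momentGen c 0)^[p] s with hf
    have hf0 : f ≠ 0 := momentGen_iterate_ne_zero hcr hs0 p
    have hft : f ≠ ⊤ := ne_top_of_le_ne_top ENNReal.one_ne_top (momentGen_iterate_le_one hδ hs p)
    -- The induction hypothesis needs a nonzero population; since `r ≥ 1`, only sizes at least `k *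
    -- r ≥ 1` matter.
    calc _ ≤ branch c k fun z => momentFactor c ℓ s p * f⁻¹ * ((z : ℝ≥0∞) ^ ℓ * f ^ z) := by
          refine branch_mono_of_le hc k fun z hz => ?_
          have hz0 : z ≠ 0 := by
            have := Nat.mul_pos (Nat.pos_of_ne_zero hk) hr
            omega
          refine (ih z hz0).trans (le_of_eq ?_)
          obtain ⟨y, rfl⟩ := Nat.exists_eq_succ_of_ne_zero hz0
          rw [Nat.succ_eq_add_one, Nat.add_sub_cancel, pow_succ']
          calc _ = momentFactor c ℓ s p * ((y + 1 : ℕ) ^ ℓ * (1 * f ^ y)) := by ring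
            _ = _ := by rw [← ENNReal.inv_mul_cancel hf0 hft]; ring
      _ ≤ _ := by
          rw [branch_const_mul]
          refine (mul_le_mul_right (branch_natPow_mul_pow_le ℓ f k hk) _).trans (le_of_eq ?_)
          ring

theorem branchOp_iterate_natPow_ne_top (ℓ : ℕ) (hc : c 0 = 0) (hδ : momentGen c 0 1 ≤ 1)
    (hA : momentGen c ℓ 1 ≠ ⊤) (p k : ℕ) (hk : k ≠ 0) :
    (branchOp c)^[p] (fun z => (z : ℝ≥0∞) ^ ℓ) k ≠ ⊤ := by
  have hle : (branchOp c)^[p] (fun z => (z : ℝ≥0∞) ^ ℓ) k ≤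
      momentGen c ℓ 1 ^ p * (k : ℝ≥0∞) ^ ℓ := by
    induction p generalizing k with
    | zero => simp
    | succ p ih =>
      rw [Function.iterate_succ_apply']
      calc _ ≤ branch c k fun z => momentGen c ℓ 1 ^ p * ((z : ℝ≥0∞) ^ ℓ * 1 ^ z) := by
            refine branch_mono_of_le (r := 1) (by simpa using hc) k fun z hz => ?_
            refine (ih z (by omega)).trans (by simp)
        _ ≤ _ := by
            rw [branch_const_mul, pow_succ, mul_assoc]
            gcongr
            refine (branch_natPow_mul_pow_le ℓ 1 k hk).trans ?_
            rw [mul_comm]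
            gcongr
            exact mul_le_of_le_one_right' (pow_le_one' hδ _)
  exact ne_top_of_le_ne_top (ENNReal.mul_ne_top (ENNReal.pow_ne_top hA)
    (ENNReal.pow_ne_top (ENNReal.natCast_ne_top _))) hle

theorem tendsto_zero_of_eventually_succ_le {x : ℕ → ℝ≥0∞} {θ : ℝ≥0∞} (hθ : θ < 1)
    (hx : ∀ p, x p ≠ ⊤) (h : ∀ᶠ p in atTop, x (p + 1) ≤ θ * x p) : Tendsto x atTop (𝓝 0) := by
  obtain ⟨N, hN⟩ := eventually_atTop.1 h
  rw [← tendsto_add_atTop_iff_nat N]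
  have hle : ∀ p, x (p + N) ≤ θ ^ p * x N := by
    intro p
    induction p with
    | zero => simp
    | succ p ih =>
      rw [Nat.succ_add, pow_succ', mul_assoc]
      exact (hN _ (by omega)).trans (mul_le_mul_right ih _)
  have := ENNReal.Tendsto.mul_const (ENNReal.tendsto_pow_atTop_nhds_zero_of_lt_one hθ)
    (Or.inr (hx N))
  rw [zero_mul] at this
  exact tendsto_of_tendsto_of_tendsto_of_le_of_le tendsto_const_nhds this (fun _ => zero_le) hle

theorem inv_mul_momentGen_le (hc : c 0 = 0) (ℓ : ℕ) {s : ℝ≥0∞} (hs0 : s ≠ 0) (hs : s ≤ 1) :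
    s⁻¹ * momentGen c ℓ s ≤ c 1 + momentGen c ℓ 1 * s := by
  have hst : s ≠ ⊤ := ne_top_of_le_ne_top ENNReal.one_ne_top hs
  refine (mul_le_mul_right (momentGen_le_add hc ℓ hs) _).trans (le_of_eq ?_)
  calc _ = s⁻¹ * s * (c 1 + momentGen c ℓ 1 * s) := by ring
    _ = _ := by rw [ENNReal.inv_mul_cancel hs0 hst, one_mul]

/-- With `c 1 = 0`, the successive ratios are at most `momentGen c ℓ 1` times an iterate that tends
to 0. -/
theorem tendsto_momentFactor (hc0 : c 0 = 0) (hc1 : c 1 = 0) (hcr : c r ≠ 0)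
    (hδ : momentGen c 0 1 < 1) (ℓ : ℕ) (hA : momentGen c ℓ 1 ≠ ⊤) {s : ℝ≥0∞} (hs : s ≤ 1)
    (hs0 : s ≠ 0) : Tendsto (momentFactor c ℓ s) atTop (𝓝 0) := by
  refine tendsto_zero_of_eventually_succ_le (θ := 2⁻¹) (by simp)
    (momentFactor_ne_top ℓ hcr hδ.le hA hs hs0) ?_
  have hlim := ENNReal.Tendsto.const_mul (a := momentGen c ℓ 1)
    (tendsto_momentGen_iterate hc0 hδ hs) (Or.inr hA)
  rw [mul_zero] at hlim
  filter_upwards [hlim.eventually_lt_const (show (0 : ℝ≥0∞) < 2⁻¹ by simp)] with p hp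
  rw [momentFactor_succ, mul_comm]
  gcongr
  refine (inv_mul_momentGen_le hc0 ℓ (momentGen_iterate_ne_zero hcr hs0 p)
    (momentGen_iterate_le_one hδ.le hs p)).trans ?_
  rw [hc1, zero_add]
  exact hp.le

/-- One generation multiplies the moment factor by at most c₁ + A f_p, the iterate by at most δ, and
the last factor by c₁⁻¹. The product of these bounds tends to δ < 1. -/
theorem tendsto_momentFactor_mul (hc0 : c 0 = 0) (hc1 : c 1 ≠ 0) (hc1t : c 1 ≠ ⊤)
    (hδ : momentGen c 0 1 < 1) (ℓ : ℕ) (hA : momentGen c ℓ 1 ≠ ⊤) {s : ℝ≥0∞} (hs : s ≤ 1)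
    (hs0 : s ≠ 0) :
    Tendsto (fun p => momentFactor c ℓ s p * (momentGen c 0)^[p] s * (c 1)⁻¹ ^ p)
      atTop (𝓝 0) := by
  obtain ⟨θ, hδθ, hθ⟩ := exists_between hδ
  refine tendsto_zero_of_eventually_succ_le hθ (fun p => ?_) ?_
  · exact ENNReal.mul_ne_top (ENNReal.mul_ne_top (momentFactor_ne_top ℓ hc1 hδ.le hA hs hs0 p)
      (ne_top_of_le_ne_top ENNReal.one_ne_top (momentGen_iterate_le_one hδ.le hs p)))
      (ENNReal.pow_ne_top (ENNReal.inv_ne_top.2 hc1))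
  have hlim : Tendsto (fun p => (c 1)⁻¹ * (c 1 + momentGen c ℓ 1 * (momentGen c 0)^[p] s) *
      momentGen c 0 1) atTop (𝓝 ((c 1)⁻¹ * (c 1 + momentGen c ℓ 1 * 0) * momentGen c 0 1)) := by
    refine ENNReal.Tendsto.mul_const (ENNReal.Tendsto.const_mul (tendsto_const_nhds.add
      (ENNReal.Tendsto.const_mul (tendsto_momentGen_iterate hc0 hδ hs) (Or.inr hA))) ?_) ?_
    · exact Or.inr (ENNReal.inv_ne_top.2 hc1)
    · exact Or.inr (ne_top_of_lt hδ)
  rw [mul_zero, add_zero, ENNReal.inv_mul_cancel hc1 hc1t, one_mul] at hlim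
  filter_upwards [hlim.eventually_lt_const hδθ] with p hp
  rw [momentFactor_succ, pow_succ]
  set f := (momentGen c 0)^[p] s
  calc _ ≤ momentFactor c ℓ s p * (c 1 + momentGen c ℓ 1 * f) * (momentGen c 0 1 * f) *
        ((c 1)⁻¹ ^ p * (c 1)⁻¹) := by
        gcongr
        · exact inv_mul_momentGen_le hc0 ℓ (momentGen_iterate_ne_zero hc1 hs0 p)
            (momentGen_iterate_le_one hδ.le hs p)
        · exact momentGen_iterate_succ_le hc0 hδ.le hs p
    _ = (c 1)⁻¹ * (c 1 + momentGen c ℓ 1 * f) * momentGen c 0 1 *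
        (momentFactor c ℓ s p * f * (c 1)⁻¹ ^ p) := by ring
    _ ≤ _ := by gcongr

theorem branchOp_iterate_choose_le (hr : 1 ≤ r) (hc : ∀ j < r, c j = 0) (hcr : c r ≠ 0)
    (hδ : momentGen c 0 1 ≤ 1) (ℓ : ℕ) {s : ℝ≥0∞} (hs : s ≤ 1) (hs0 : s ≠ 0) (p k : ℕ)
    (hk : k ≠ 0) :
    (branchOp c)^[p] (fun z => (z.choose ℓ : ℝ≥0∞) * s ^ z) k ≤
      (k : ℝ≥0∞) ^ ℓ * (momentFactor c ℓ s p * ((momentGen c 0)^[p] s) ^ (k - 1)) := by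
  refine (branchOp_iterate_mono k p fun z => ?_).trans
    (branchOp_iterate_natPow_mul_pow_le hr hc hcr hδ ℓ hs hs0 p k hk)
  gcongr
  exact_mod_cast Nat.choose_le_pow z ℓ

/-- Starting from more than `m = r ^ n` individuals is negligible with respect to starting from `m`. -/
theorem exists_tendsto_zero_branchOp_iterate_choose_le (hr : 1 ≤ r) (hc : ∀ j < r, c j = 0)
    (hcr : c r ≠ 0) (hδ : momentGen c 0 1 < 1) (ℓ : ℕ) (hA : momentGen c ℓ 1 ≠ ⊤) {s : ℝ≥0∞}
    (hs : s ≤ 1) (hs0 : s ≠ 0) (h2 : r = 1 → 2 ≤ ℓ → ∃ j, 2 ≤ j ∧ c j ≠ 0) (n : ℕ) :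
    ∃ ε : ℕ → ℝ≥0∞, Tendsto ε atTop (𝓝 0) ∧ ∀ᶠ p in atTop,
      (branchOp c)^[p] (fun z => (z.choose ℓ : ℝ≥0∞) * s ^ z) (r ^ n) ≠ 0 ∧
      ∀ k, r ^ n < k → (branchOp c)^[p] (fun z => (z.choose ℓ : ℝ≥0∞) * s ^ z) k ≤
        ε p * (branchOp c)^[p] (fun z => (z.choose ℓ : ℝ≥0∞) * s ^ z) (r ^ n) *
          (k : ℝ≥0∞) ^ ℓ := by
  set g : ℕ → ℝ≥0∞ := fun z => (z.choose ℓ : ℝ≥0∞) * s ^ z with hg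
  have hc0 : c 0 = 0 := hc 0 hr
  rcases hr.eq_or_lt' with rfl | hr2
  -- For `r = 1`, the reference value from one individual is positive at some time `p₀`. If `ℓ ≥ 2`,
  -- offspring number `j ≥ 2` repeated `ℓ` times gives j^ℓ ≥ ℓ individuals; if `ℓ ≤ 1`, time 0 is
  -- enough.
  · have hpos : ∃ p₀, (branchOp c)^[p₀] g 1 ≠ 0 := by
      by_cases hℓ : 2 ≤ ℓ
      · obtain ⟨j, hj, hcj⟩ := h2 rfl hℓ
        refine ⟨ℓ, branchOp_iterate_pos hcj 1 ℓ g ?_⟩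
        have : ℓ ≤ 1 * j ^ ℓ := by
          rw [one_mul]
          exact (Nat.lt_pow_self (by omega)).le
        have := (Nat.choose_pos this).ne'
        simp only [hg]
        exact mul_ne_zero (by exact_mod_cast this) (pow_ne_zero _ hs0)
      · refine ⟨0, ?_⟩
        have := (Nat.choose_pos (show ℓ ≤ 1 by omega)).ne'
        simp only [hg, Function.iterate_zero, id]
        exact mul_ne_zero (by exact_mod_cast this) (pow_ne_zero _ hs0)
    obtain ⟨p₀, hp₀⟩ := hpos
    have hc1t : c 1 ≠ ⊤ := by
      refine ne_top_of_lt (lt_of_le_of_lt ?_ hδ)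
      exact (by simp : c 1 ≤ c 1 * ((1 : ℕ) ^ 0 * 1 ^ 1)).trans (ENNReal.le_tsum 1)
    have hlow : ∀ p, p₀ ≤ p → c 1 ^ p * (branchOp c)^[p₀] g 1 ≤
        c 1 ^ p₀ * (branchOp c)^[p] g 1 := by
      intro p hp
      obtain ⟨i, rfl⟩ := Nat.exists_eq_add_of_le' hp
      rw [pow_add, mul_comm (c 1 ^ i), mul_assoc]
      exact mul_le_mul_right (pow_mul_branchOp_iterate_le i p₀ g) _
    -- This constant turns the lower bound into c₁^p ≤ C times the reference value for `p ≥ p₀`.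
    set C := c 1 ^ p₀ * ((branchOp c)^[p₀] g 1)⁻¹ with hC
    have hCt : C ≠ ⊤ := ENNReal.mul_ne_top (ENNReal.pow_ne_top hc1t) (ENNReal.inv_ne_top.2 hp₀)
    have hgt : ∀ p, (branchOp c)^[p] g 1 ≠ ⊤ := fun p => by
      refine ne_top_of_le_ne_top ?_
        (branchOp_iterate_choose_le le_rfl hc hcr hδ.le ℓ hs hs0 p 1 one_ne_zero)
      simpa using momentFactor_ne_top ℓ hcr hδ.le hA hs hs0 p
    have hlow' : ∀ p, p₀ ≤ p → c 1 ^ p ≤ C * (branchOp c)^[p] g 1 := by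
      intro p hp
      have := mul_le_mul_left (hlow p hp) ((branchOp c)^[p₀] g 1)⁻¹
      rw [mul_assoc, ENNReal.mul_inv_cancel hp₀ (hgt p₀), mul_one] at this
      refine this.trans (le_of_eq ?_)
      rw [hC]; ring
    have hlim := ENNReal.Tendsto.mul_const
      (tendsto_momentFactor_mul hc0 hcr hc1t hδ ℓ hA hs hs0) (Or.inr hCt)
    rw [zero_mul] at hlim
    refine ⟨_, hlim, ?_⟩
    · filter_upwards [eventually_ge_atTop p₀] with p hp
      simp only [one_pow]
      refine ⟨fun h0 => ?_, fun k hk => ?_⟩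
      · have := hlow p hp
        rw [h0, mul_zero] at this
        exact mul_ne_zero (pow_ne_zero _ hcr) hp₀ (le_antisymm this zero_le)
      · refine (branchOp_iterate_choose_le le_rfl hc hcr hδ.le ℓ hs hs0 p k (by omega)).trans ?_
        rw [mul_comm]
        refine mul_le_mul_left (b := momentFactor c ℓ s p * _)
          (c := (momentFactor c ℓ s p * (momentGen c 0)^[p] s * (c 1)⁻¹ ^ p * C) *
            (branchOp c)^[p] g 1) ?_ _
        -- Since `k ≥ 2`, at least one factor f_p is available; it makes the limit vanish.
        calc _ ≤ momentFactor c ℓ s p * (momentGen c 0)^[p] s * ((c 1)⁻¹ ^ p * c 1 ^ p) := by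
              rw [← mul_pow, ENNReal.inv_mul_cancel hcr hc1t, one_pow, mul_one]
              gcongr
              exact (pow_le_pow_right_of_le_one' (momentGen_iterate_le_one hδ.le hs p)
                (show 1 ≤ k - 1 by omega)).trans_eq (pow_one _)
          _ ≤ _ := by
              rw [mul_assoc _ C, ← mul_assoc]
              gcongr
              exact hlow' p hp
  · refine ⟨_, tendsto_momentFactor hc0 (hc 1 hr2) hcr hδ ℓ hA hs hs0, ?_⟩
    -- For `r ≥ 2` and `p ≥ ℓ`, every population reached exceeds `ℓ`, up to equality, so the
    -- binomial coefficient is at least 1 and the reference value is at least f_p^(r^n).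
    filter_upwards [eventually_ge_atTop ℓ] with p hp
    have hlow : ((momentGen c 0)^[p] s) ^ (r ^ n) ≤ (branchOp c)^[p] g (r ^ n) := by
      rw [← congrFun (branchOp_iterate_pow s p) (r ^ n)]
      refine branchOp_iterate_mono_of_le hc _ _ fun z hz => ?_
      have hzℓ : ℓ ≤ z := calc
        ℓ ≤ p := hp
        _ ≤ r ^ p := (Nat.lt_pow_self hr2).le
        _ ≤ r ^ n * r ^ p := Nat.le_mul_of_pos_left _ (by positivity)
        _ ≤ z := hz
      have h1 : (1 : ℝ≥0∞) ≤ (z.choose ℓ : ℝ≥0∞) := by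
        exact_mod_cast Nat.choose_pos hzℓ
      exact le_mul_of_one_le_left' h1
    refine ⟨fun h0 => ?_, fun k hk => ?_⟩
    · rw [h0] at hlow
      exact pow_ne_zero _ (momentGen_iterate_ne_zero hcr hs0 p) (le_antisymm hlow zero_le)
    · refine (branchOp_iterate_choose_le hr hc hcr hδ.le ℓ hs hs0 p k (by omega)).trans ?_
      rw [mul_comm]
      gcongr
      refine le_trans ?_ hlow
      exact pow_le_pow_right_of_le_one' (momentGen_iterate_le_one hδ.le hs p) (by omega)

end Iterate

/-! ### Integration over cylinders of the product space -/

theorem measurableSet_cylinder (D L : Finset Node) (x : Node → ℕ × Bool) :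
    MeasurableSet {ω : Node → ℕ × Bool | (∀ u ∈ D, ω u = x u) ∧ ∀ u ∈ L, (ω u).2 = false} := by
  have h1 : {ω : Node → ℕ × Bool | (∀ u ∈ D, ω u = x u) ∧ ∀ u ∈ L, (ω u).2 = false} =
      Set.pi (D : Set Node) (fun u => {x u}) ∩ Set.pi (L : Set Node) fun _ => {y | y.2 = false} := by
    ext ω; simp [Set.mem_pi]
  rw [h1]
  exact (MeasurableSet.pi (Finset.countable_toSet _) fun _ _ => measurableSet_singleton _).inter
    (MeasurableSet.pi (Finset.countable_toSet _) fun _ _ => MeasurableSet.of_discrete)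

/-- Data are prescribed on `D`, while nodes of `L` are only required to be unmarked. The induction
splits according to the offspring number of one node of `L` and moves this node to `D`, hence the
arbitrary `D` and `x`. -/
theorem setLIntegral_cylinder (p₀ : PMF (ℕ × Bool)) (L : Finset Node) :
    ∀ (D : Finset Node) (_ : Disjoint D L) (x : Node → ℕ × Bool) (g : ℕ → ℝ≥0∞),
      ∫⁻ ω in {ω : Node → ℕ × Bool | (∀ u ∈ D, ω u = x u) ∧ ∀ u ∈ L, (ω u).2 = false},
        g (∑ u ∈ L, (ω u).1) ∂(Measure.infinitePi fun _ : Node => p₀.toMeasure) =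
      (∏ u ∈ D, p₀ (x u)) * branch (fun j => p₀ (j, false)) L.card g := by
  induction L using Finset.induction_on with
  | empty =>
    intro D _ x g
    have h1 : {ω : Node → ℕ × Bool | (∀ u ∈ D, ω u = x u) ∧ ∀ u ∈ (∅ : Finset Node),
        (ω u).2 = false} = Set.pi (D : Set Node) (fun u => {x u}) := by
      ext ω; simp [Set.mem_pi]
    rw [h1]
    simp only [Finset.sum_empty, lintegral_const, Measure.restrict_apply MeasurableSet.univ,
      Set.univ_inter, Finset.card_empty, branch]
    rw [Measure.infinitePi_pi _ fun _ _ => measurableSet_singleton _, mul_comm]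
    congr 1
    exact Finset.prod_congr rfl fun u _ =>
      PMF.toMeasure_apply_singleton _ _ (measurableSet_singleton _)
  | insert v L hv ih =>
    intro D hD x g
    rw [Finset.disjoint_insert_right] at hD
    have hset : {ω : Node → ℕ × Bool | (∀ u ∈ D, ω u = x u) ∧ ∀ u ∈ insert v L, (ω u).2 = false} =
        ⋃ j : ℕ, {ω | (∀ u ∈ insert v D, ω u = Function.update x v (j, false) u) ∧
          ∀ u ∈ L, (ω u).2 = false} := by
      ext ω
      simp only [Set.mem_ofPred_eq, Set.mem_iUnion, Finset.forall_mem_insert,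
        Function.update_self]
      have hne : ∀ j, (∀ u ∈ D, ω u = Function.update x v (j, false) u) ↔ ∀ u ∈ D, ω u = x u := by
        intro j
        refine forall₂_congr fun u hu => ?_
        rw [Function.update_of_ne]
        rintro rfl
        exact hD.1 hu
      simp only [hne]
      constructor
      · rintro ⟨h1, h2, h3⟩
        exact ⟨(ω v).1, ⟨Prod.ext rfl h2, h1⟩, h3⟩
      · rintro ⟨j, ⟨h1, h2⟩, h3⟩
        exact ⟨h2, by rw [h1], h3⟩
    rw [hset, lintegral_iUnion (fun j => measurableSet_cylinder _ _ _), Finset.card_insert_of_notMem hv,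
      branch, ← ENNReal.tsum_mul_left]
    · refine tsum_congr fun j => ?_
      have hcongr : ∀ ω ∈ {ω : Node → ℕ × Bool |
          (∀ u ∈ insert v D, ω u = Function.update x v (j, false) u) ∧ ∀ u ∈ L, (ω u).2 = false},
          g (∑ u ∈ insert v L, (ω u).1) = (fun z => g (j + z)) (∑ u ∈ L, (ω u).1) := by
        intro ω hω
        have := hω.1 v (Finset.mem_insert_self _ _)
        rw [Finset.sum_insert hv, this, Function.update_self]
      refine (setLIntegral_congr_fun (measurableSet_cylinder _ _ _) hcongr).trans
        ((ih _ (Finset.disjoint_insert_left.2 ⟨hv, hD.2⟩) _ fun z => g (j + z)).trans ?_)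
      rw [Finset.prod_insert hD.1, Function.update_self, mul_comm (p₀ (j, false)), mul_assoc]
      congr 1
      refine Finset.prod_congr rfl fun u hu => ?_
      rw [Function.update_of_ne]
      rintro rfl
      exact hD.1 hu
    · intro i j hij
      refine Set.disjoint_left.2 fun ω hi hj => hij ?_
      have h1 := hi.1 v (Finset.mem_insert_self _ _)
      have h2 := hj.1 v (Finset.mem_insert_self _ _)
      rw [h1, Function.update_self, Function.update_self] at h2
      exact congrArg Prod.fst h2

/-! ### Generation sizes and marks as functions of the restrictions -/

namespace MarkedTree

theorem Z_eq_card (T : MarkedTree) (n : ℕ) : T.Z n = (T.finite_level n).toFinset.card :=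
  Set.ncard_eq_toFinset_card _ _

theorem Z_zero (T : MarkedTree) : T.Z 0 = 1 := by
  rw [Z, Set.ncard_eq_one]
  refine ⟨[], ?_⟩
  ext u
  simp only [Set.mem_ofPred_eq, List.length_eq_zero_iff, Set.mem_singleton_iff]
  exact ⟨fun h => h.2, fun h => ⟨h ▸ T.root_mem, h⟩⟩

theorem M_eq_zero_iff (T : MarkedTree) (n : ℕ) : T.M n = 0 ↔ ∀ u ∈ T.marked, n ≤ u.length := by
  -- Finiteness matters: `ncard` is also 0 on infinite sets.
  have hf : {u | u ∈ T.marked ∧ u.length < n}.Finite :=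
    (T.finite_lt n).subset fun u hu => ⟨T.marked_subset hu.1, hu.2⟩
  rw [M, Set.ncard_eq_zero hf, Set.eq_empty_iff_forall_notMem]
  simp

theorem M_zero (T : MarkedTree) : T.M 0 = 0 := by
  rw [M_eq_zero_iff]; simp

theorem Z_restrict (T : MarkedTree) (n : ℕ) : (T.restrict n).Z n = T.Z n := by
  rw [Z, Z]
  congr 1
  ext u
  simp only [restrict, Set.mem_ofPred_eq]
  exact ⟨fun h => ⟨h.1.1, h.2⟩, fun h => ⟨⟨h.1, h.2.le⟩, h.2⟩⟩

theorem M_restrict (T : MarkedTree) (n : ℕ) : (T.restrict n).M n = T.M n := by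
  rw [M, M]
  congr 1
  ext u
  simp only [restrict, Set.mem_ofPred_eq, and_assoc, and_self]

/-- The nodes of generation `n + 1` are sorted by their parent, `List.dropLast`. -/
theorem Z_succ (T : MarkedTree) (n : ℕ) :
    T.Z (n + 1) = ∑ u ∈ (T.finite_level n).toFinset, T.numChildren u := by
  rw [Z_eq_card, Finset.card_eq_sum_card_fiberwise (f := List.dropLast)
    (t := (T.finite_level n).toFinset)]
  · refine Finset.sum_congr rfl fun u hu => ?_
    rw [Set.Finite.mem_toFinset] at hu
    rw [numChildren, ← Set.ncard_image_of_injective (f := fun i : ℕ+ => u ++ [i]) _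
      (fun i j h => by simpa using h), ← Set.ncard_coe_finset]
    congr 1
    ext v
    simp only [Finset.coe_filter, Set.Finite.mem_toFinset, Set.mem_ofPred_eq, Set.mem_image]
    constructor
    · rintro ⟨⟨hv, hl⟩, rfl⟩
      have hne : v ≠ [] := by rintro rfl; simp at hl
      refine ⟨v.getLast hne, ?_, List.dropLast_append_getLast hne⟩
      rwa [List.dropLast_append_getLast hne]
    · rintro ⟨i, hi, rfl⟩
      refine ⟨⟨hi, ?_⟩, by simp⟩
      simp [hu.2]
  · intro v hv
    rw [Finset.mem_coe, Set.Finite.mem_toFinset] at hv ⊢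
    have hl := hv.2
    have hne : v ≠ [] := by rintro rfl; simp at hl
    refine ⟨T.parent_mem _ (v.getLast hne) ?_, by simp [hl]⟩
    rw [List.dropLast_append_getLast hne]
    exact hv.1

theorem measurable_of_restrict {α : Type*} [MeasurableSpace α] {n : ℕ} {φ : MarkedTree → α}
    (h : ∀ T, φ (T.restrict n) = φ T) : Measurable[sigmaAlgebra n] φ := by
  intro s _
  refine ⟨φ ⁻¹' s, trivial, ?_⟩
  ext T
  simp [h]

theorem measurable_Z (n : ℕ) : Measurable (Z n) :=
  (measurable_of_restrict fun T => Z_restrict T n).mono (filtration.le n) le_rfl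

theorem measurable_M (n : ℕ) : Measurable (M n) :=
  (measurable_of_restrict fun T => M_restrict T n).mono (filtration.le n) le_rfl

theorem measurableSet_M_eq_zero (n : ℕ) : MeasurableSet {T : MarkedTree | T.M n = 0} :=
  measurable_M n (measurableSet_singleton 0)

theorem mem_nodes_iff_of_restrict_eq {S T : MarkedTree} {n : ℕ} (h : S.restrict n = T.restrict n)
    {u : Node} (hu : u.length ≤ n) : u ∈ S.nodes ↔ u ∈ T.nodes := by
  have := congrArg (fun S : MarkedTree => u ∈ S.nodes) h
  simpa [restrict, hu] using this

theorem M_eq_of_restrict_eq {S T : MarkedTree} {n : ℕ} (h : S.restrict n = T.restrict n) :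
    S.M n = T.M n := by
  rw [← M_restrict, h, M_restrict]

theorem Z_eq_of_restrict_eq {S T : MarkedTree} {n : ℕ} (h : S.restrict n = T.restrict n) :
    S.Z n = T.Z n := by
  rw [← Z_restrict, h, Z_restrict]

theorem numChildren_ofData {ω : Node → ℕ × Bool} {u : Node} (hu : u ∈ (ofData ω).nodes) :
    (ofData ω).numChildren u = (ω u).1 := by
  refine numChildren_eq fun i => ⟨fun hi => hi u i (List.prefix_refl _), fun hi v j hv => ?_⟩
  rcases List.prefix_concat_iff.1 hv with hv | hv
  · obtain ⟨rfl, hj⟩ := List.append_inj' hv rfl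
    rw [List.cons.injEq] at hj
    rw [hj.1]; exact hi
  · exact hu v j hv

theorem M_succ_eq_zero_iff (T : MarkedTree) (n : ℕ) :
    T.M (n + 1) = 0 ↔ T.M n = 0 ∧ ∀ u ∈ T.nodes, u.length = n → u ∉ T.marked := by
  rw [M_eq_zero_iff, M_eq_zero_iff]
  constructor
  · intro h
    refine ⟨fun u hu => by have := h u hu; omega, fun u _ hl hu => ?_⟩
    have := h u hu
    omega
  · rintro ⟨h1, h2⟩ u hu
    have := h1 u hu
    by_contra hlt
    exact h2 u (T.marked_subset hu) (by omega) hu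

theorem Z_succ_ofData {ω : Node → ℕ × Bool} {T : MarkedTree} {n : ℕ}
    (h : (ofData ω).restrict n = T.restrict n) :
    (ofData ω).Z (n + 1) = ∑ u ∈ (T.finite_level n).toFinset, (ω u).1 := by
  rw [Z_succ]
  have hL : ((ofData ω).finite_level n).toFinset = (T.finite_level n).toFinset := by
    ext u
    simp only [Set.Finite.mem_toFinset, Set.mem_ofPred_eq]
    exact and_congr_left fun hl => mem_nodes_iff_of_restrict_eq h hl.le
  rw [hL]
  refine Finset.sum_congr rfl fun u hu => numChildren_ofData ?_
  rw [← hL, Set.Finite.mem_toFinset] at hu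
  exact hu.1

theorem M_succ_ofData {ω : Node → ℕ × Bool} {T : MarkedTree} {n : ℕ}
    (h : (ofData ω).restrict n = T.restrict n) :
    (ofData ω).M (n + 1) = 0 ↔ T.M n = 0 ∧ ∀ u ∈ (T.finite_level n).toFinset, (ω u).2 = false := by
  rw [M_succ_eq_zero_iff, M_eq_of_restrict_eq h]
  refine and_congr_right fun _ => ?_
  simp only [Set.Finite.mem_toFinset, Set.mem_ofPred_eq, and_imp]
  refine forall_congr' fun u => ?_
  constructor
  · intro H hu hl
    have hu' := (mem_nodes_iff_of_restrict_eq h hl.le).2 hu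
    exact Bool.eq_false_iff.2 fun hm => H hu' hl ⟨hu', hm⟩
  · intro H hu hl hm
    have h1 := H ((mem_nodes_iff_of_restrict_eq h hl.le).1 hu) hl
    have h2 : (ω u).2 = true := hm.2
    rw [h1] at h2
    exact Bool.false_ne_true h2

end MarkedTree

open MarkedTree

/-! ### The Markov property on the event without marks -/

theorem mgwLaw_fiber (p₀ : PMF (ℕ × Bool)) (n : ℕ) (T : MarkedTree) :
    mgwLaw p₀ (restrict n ⁻¹' {T.restrict n}) =
      ∏ u ∈ (T.finite_lt n).toFinset, p₀ (T.numChildren u, T.mark u) := by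
  rw [mgwLaw, Measure.map_apply measurable_ofData (measurableSet_fiber _ _),
    ofData_preimage, Measure.infinitePi_pi _ fun _ _ => measurableSet_singleton _]
  exact Finset.prod_congr rfl fun u _ =>
    PMF.toMeasure_apply_singleton _ _ (measurableSet_singleton _)

/-- The restriction to level `n` fixes only the data below level `n`, so those at level `n` are
still independent with law `p₀`. Both sides vanish if `T` has a mark below level `n`. -/
theorem setLIntegral_fiber (p₀ : PMF (ℕ × Bool)) (n : ℕ) (T : MarkedTree) (g : ℕ → ℝ≥0∞) :
    ∫⁻ S in restrict n ⁻¹' {T.restrict n} ∩ {S | S.M (n + 1) = 0}, g (S.Z (n + 1)) ∂mgwLaw p₀ =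
      ∫⁻ S in restrict n ⁻¹' {T.restrict n} ∩ {S | S.M n = 0},
        branchOp (fun j => p₀ (j, false)) g (S.Z n) ∂mgwLaw p₀ := by
  by_cases hM : T.M n = 0
  · have hR : restrict n ⁻¹' {T.restrict n} ∩ {S | S.M n = 0} = restrict n ⁻¹' {T.restrict n} := by
      refine Set.inter_eq_left.2 fun S hS => ?_
      exact (M_eq_of_restrict_eq hS).trans hM
    have hcongr : ∀ S ∈ restrict n ⁻¹' {T.restrict n},
        branchOp (fun j => p₀ (j, false)) g (S.Z n) =
          branch (fun j => p₀ (j, false)) (T.Z n) g := by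
      intro S hS
      rw [Z_eq_of_restrict_eq hS]
      rfl
    have hset : ofData ⁻¹' (restrict n ⁻¹' {T.restrict n} ∩ {S | S.M (n + 1) = 0}) =
        {ω | (∀ u ∈ (T.finite_lt n).toFinset, ω u = (T.numChildren u, T.mark u)) ∧
          ∀ u ∈ (T.finite_level n).toFinset, (ω u).2 = false} := by
      ext ω
      simp only [Set.preimage_inter, Set.mem_inter_iff, ofData_preimage, Set.mem_pi,
        Set.mem_preimage, Set.mem_ofPred_eq, Finset.mem_coe, Set.mem_singleton_iff]
      refine and_congr_right fun hω => ?_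
      have : (ofData ω).restrict n = T.restrict n := by
        rw [ofData_restrict_eq_iff]
        intro u hu
        exact hω u ((Set.Finite.mem_toFinset _).2 hu)
      rw [M_succ_ofData this]
      simp only [hM, true_and]
    have hcongr2 : ∀ ω ∈ {ω : Node → ℕ × Bool |
        (∀ u ∈ (T.finite_lt n).toFinset, ω u = (T.numChildren u, T.mark u)) ∧
          ∀ u ∈ (T.finite_level n).toFinset, (ω u).2 = false},
        g ((ofData ω).Z (n + 1)) = g (∑ u ∈ (T.finite_level n).toFinset, (ω u).1) := by
      intro ω hω
      rw [Z_succ_ofData]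
      rw [ofData_restrict_eq_iff]
      intro u hu
      exact hω.1 u ((Set.Finite.mem_toFinset _).2 hu)
    have hdisj : Disjoint (T.finite_lt n).toFinset (T.finite_level n).toFinset := by
      refine Finset.disjoint_left.2 fun u h1 h2 => ?_
      rw [Set.Finite.mem_toFinset] at h1 h2
      exact h1.2.ne h2.2
    have hg : Measurable fun S : MarkedTree => g (S.Z (n + 1)) :=
      (measurable_from_nat (f := g)).comp (measurable_Z _)
    rw [hR, setLIntegral_congr_fun (measurableSet_fiber _ _) hcongr, setLIntegral_const,
      mgwLaw_fiber, mgwLaw, setLIntegral_map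
      ((measurableSet_fiber _ _).inter (measurableSet_M_eq_zero _)) hg measurable_ofData, hset,
      setLIntegral_congr_fun (measurableSet_cylinder _ _ _) hcongr2,
      setLIntegral_cylinder _ _ _ hdisj, ← Z_eq_card, mul_comm]
  · have h1 : restrict n ⁻¹' {T.restrict n} ∩ {S | S.M n = 0} = ∅ := by
      refine Set.eq_empty_of_forall_notMem fun S hS => hM ?_
      rw [← M_eq_of_restrict_eq hS.1]
      exact hS.2
    have h2 : restrict n ⁻¹' {T.restrict n} ∩ {S | S.M (n + 1) = 0} = ∅ := by
      refine Set.eq_empty_of_forall_notMem fun S hS => hM ?_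
      rw [← M_eq_of_restrict_eq hS.1]
      exact ((M_succ_eq_zero_iff S n).1 hS.2).1
    rw [h1, h2, setLIntegral_empty, setLIntegral_empty]

/-- On the event that there is no mark, `(Z_n)` is a Markov chain with transition operator
`branchOp`. -/
theorem setLIntegral_succ (p₀ : PMF (ℕ × Bool)) (n : ℕ) {Λ : Set MarkedTree}
    (hΛ : MeasurableSet[filtration n] Λ) (g : ℕ → ℝ≥0∞) :
    ∫⁻ S in Λ ∩ {S | S.M (n + 1) = 0}, g (S.Z (n + 1)) ∂mgwLaw p₀ =
      ∫⁻ S in Λ ∩ {S | S.M n = 0}, branchOp (fun j => p₀ (j, false)) g (S.Z n) ∂mgwLaw p₀ := by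
  obtain ⟨A, -, rfl⟩ := hΛ
  have hc := (countable_range_restrict n).mono (Set.inter_subset_right (s := A))
  have hd : ∀ B : Set MarkedTree, (A ∩ Set.range (restrict n)).PairwiseDisjoint
      fun S => restrict n ⁻¹' {S} ∩ B := fun B S _ T _ hST =>
    ((Set.disjoint_singleton.2 hST).preimage _).mono Set.inter_subset_left Set.inter_subset_left
  rw [preimage_restrict_eq, Set.iUnion₂_inter, Set.iUnion₂_inter,
    lintegral_biUnion hc (fun S _ => (measurableSet_fiber _ _).inter (measurableSet_M_eq_zero _))
      (hd _),
    lintegral_biUnion hc (fun S _ => (measurableSet_fiber _ _).inter (measurableSet_M_eq_zero _))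
      (hd _)]
  refine tsum_congr ?_
  rintro ⟨_, -, T, rfl⟩
  exact setLIntegral_fiber p₀ n T g

theorem setLIntegral_add (p₀ : PMF (ℕ × Bool)) (n m : ℕ) {Λ : Set MarkedTree}
    (hΛ : MeasurableSet[filtration n] Λ) (g : ℕ → ℝ≥0∞) :
    ∫⁻ S in Λ ∩ {S | S.M (n + m) = 0}, g (S.Z (n + m)) ∂mgwLaw p₀ =
      ∫⁻ S in Λ ∩ {S | S.M n = 0},
        (branchOp fun j => p₀ (j, false))^[m] g (S.Z n) ∂mgwLaw p₀ := by
  induction m generalizing g with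
  | zero => rfl
  | succ m ih =>
    rw [← add_assoc, setLIntegral_succ p₀ (n + m) (filtration.mono (Nat.le_add_right n m) _ hΛ),
      ih, ← Function.iterate_succ_apply]

theorem lintegral_eq_branchOp_iterate (p₀ : PMF (ℕ × Bool)) (n : ℕ) (g : ℕ → ℝ≥0∞) :
    ∫⁻ S in {S | S.M n = 0}, g (S.Z n) ∂mgwLaw p₀ =
      (branchOp fun j => p₀ (j, false))^[n] g 1 := by
  have := (isMGWLaw_mgwLaw p₀).isProbabilityMeasure
  have h := setLIntegral_add p₀ 0 n (Λ := Set.univ) MeasurableSet.univ g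
  simpa [M_zero, Z_zero] using h

/-! ### The regular tree and its probability -/

namespace MarkedTree

theorem numChildren_regular (r : ℕ) {u : Node} (hu : u ∈ (regular r).nodes) :
    (regular r).numChildren u = r := by
  refine numChildren_eq fun i => ⟨fun h => h i (by simp), fun h j hj => ?_⟩
  rcases List.mem_append.1 hj with hj | hj
  · exact hu j hj
  · rw [List.mem_singleton.1 hj]; exact h

theorem Z_regular (r n : ℕ) : (regular r).Z n = r ^ n := by
  induction n with
  | zero => rw [Z_zero, pow_zero]
  | succ n ih =>
    rw [Z_succ, Finset.sum_congr rfl (g := fun _ => r), Finset.sum_const, ← Z_eq_card, ih,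
      smul_eq_mul, pow_succ]
    intro u hu
    rw [Set.Finite.mem_toFinset] at hu
    exact numChildren_regular r hu.1

theorem M_regular (r n : ℕ) : (regular r).M n = 0 := by
  rw [M_eq_zero_iff]
  exact fun u hu => absurd hu (Set.notMem_empty u)

theorem card_lt_regular (r n : ℕ) :
    ((regular r).finite_lt n).toFinset.card = ∑ i ∈ Finset.range n, r ^ i := by
  induction n with
  | zero => simp
  | succ n ih =>
    have : ((regular r).finite_lt (n + 1)).toFinset =
        ((regular r).finite_lt n).toFinset ∪ ((regular r).finite_level n).toFinset := by
      ext u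
      simp only [Set.Finite.mem_toFinset, Finset.mem_union, Set.mem_ofPred_eq,
        Order.lt_add_one_iff, le_iff_lt_or_eq]
      tauto
    rw [this, Finset.card_union_of_disjoint, ih, ← Z_eq_card, Z_regular, Finset.sum_range_succ]
    refine Finset.disjoint_left.2 fun u h1 h2 => ?_
    rw [Set.Finite.mem_toFinset] at h1 h2
    exact h1.2.ne h2.2

end MarkedTree

theorem mgwLaw_regular_fiber (p₀ : PMF (ℕ × Bool)) (r n : ℕ) :
    mgwLaw p₀ (restrict n ⁻¹' {(regular r).restrict n}) =
      p₀ (r, false) ^ ∑ i ∈ Finset.range n, r ^ i := by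
  rw [mgwLaw_fiber, ← card_lt_regular, Finset.prod_congr rfl (g := fun _ => p₀ (r, false)),
    Finset.prod_const]
  intro u hu
  rw [Set.Finite.mem_toFinset] at hu
  rw [numChildren_regular r hu.1]
  congr 2
  rw [mark, decide_eq_false_iff_not]
  exact Set.notMem_empty u

/-- Up to a null set, a tree without marks before generation `n` and with at most `r ^ n` nodes at
generation `n` is regular up to generation `n`. -/
theorem ae_restrict_eq_regular (p₀ : PMF (ℕ × Bool)) {r : ℕ} (hr : 1 ≤ r)
    (hc : ∀ j < r, p₀ (j, false) = 0) (n : ℕ) :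
    ∀ᵐ T ∂mgwLaw p₀, T.M n = 0 → T.Z n ≤ r ^ n → T.restrict n = (regular r).restrict n := by
  have := (isMGWLaw_mgwLaw p₀).isProbabilityMeasure
  have hsub : restrict n ⁻¹' {(regular r).restrict n} ⊆ {T | T.M n = 0} ∩ {T | T.Z n ≤ r ^ n} := by
    intro T hT
    refine ⟨(M_eq_of_restrict_eq hT).trans (M_regular r n), ?_⟩
    exact ((Z_eq_of_restrict_eq hT).trans (Z_regular r n)).le
  -- The larger event has no more mass than the regular fiber it contains, so the two agree almost
  -- everywhere.
  have hle : mgwLaw p₀ ({T | T.M n = 0} ∩ {T | T.Z n ≤ r ^ n}) ≤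
      mgwLaw p₀ (restrict n ⁻¹' {(regular r).restrict n}) := by
    have h1 := lintegral_eq_branchOp_iterate p₀ n fun z => if z ≤ r ^ n then 1 else 0
    have h2 := branchOp_iterate_le_pow_mul (c := fun j => p₀ (j, false)) hr hc 1 n
      (fun z => if z ≤ r ^ n then 1 else 0) fun z hz => if_neg (by rw [one_mul] at hz; omega)
    rw [← h1] at h2
    simp only [one_mul, le_refl, if_true, mul_one] at h2
    rw [mgwLaw_regular_fiber]
    refine le_trans (le_of_eq ?_) h2
    have hms : MeasurableSet {T : MarkedTree | T.Z n ≤ r ^ n} :=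
      measurable_Z n (MeasurableSet.of_discrete (s := Set.Iic (r ^ n)))
    have hind : ∀ T : MarkedTree, (if T.Z n ≤ r ^ n then (1 : ℝ≥0∞) else 0) =
        {T : MarkedTree | T.Z n ≤ r ^ n}.indicator 1 T := fun T => by
      simp [Set.indicator_apply]
    simp only [hind]
    rw [lintegral_indicator_one hms, Measure.restrict_apply hms, Set.inter_comm]
  have h0 := ae_eq_of_subset_of_measure_ge hsub hle
    (measurableSet_fiber _ _).nullMeasurableSet (measure_ne_top _ _)
  filter_upwards [h0.mem_iff] with T hT h1 h2
  exact hT.2 ⟨h1, h2⟩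

open MarkedTree

/-! ### The offspring law of unmarked nodes -/

section MarkLaw

variable (p : PMF ℕ) (q : ℕ → unitInterval)

theorem markLaw_false (j : ℕ) :
    markLaw p q (j, false) = p j * ENNReal.ofReal (1 - (q j : ℝ)) := rfl

theorem markLaw_false_le (j : ℕ) : markLaw p q (j, false) ≤ p j := by
  rw [markLaw_false]
  refine mul_le_of_le_one_right' (ENNReal.ofReal_le_one.2 ?_)
  linarith [(q j).2.1]

theorem markLaw_false_ne_zero_iff (j : ℕ) :
    markLaw p q (j, false) ≠ 0 ↔ 0 < (p j).toReal * (1 - (q j : ℝ)) := by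
  have h : (markLaw p q (j, false)).toReal = (p j).toReal * (1 - (q j : ℝ)) := by
    rw [markLaw_false, ENNReal.toReal_mul, ENNReal.toReal_ofReal (sub_nonneg.2 (q j).2.2)]
  rw [← h, ENNReal.toReal_pos_iff, pos_iff_ne_zero]
  exact (and_iff_left (PMF.apply_ne_top _ _).lt_top).symm

/-- The pairs with mark 1 carry the missing mass, which is positive. -/
theorem momentGen_markLaw_lt_one (hq : ∃ k, 0 < (p k).toReal * (q k : ℝ)) :
    momentGen (fun j => markLaw p q (j, false)) 0 1 < 1 := by
  obtain ⟨k, hk⟩ := hq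
  have hsum : ∑' j, markLaw p q (j, false) + ∑' j, markLaw p q (j, true) = 1 := by
    rw [← ENNReal.tsum_add, ← (markLaw p q).tsum_coe,
      ENNReal.summable.tsum_prod' fun _ => ENNReal.summable]
    refine tsum_congr fun j => ?_
    rw [tsum_fintype, Fintype.sum_bool, add_comm]
  have hpos : markLaw p q (k, true) ≠ 0 := by
    change p k * ENNReal.ofReal (q k : ℝ) ≠ 0
    refine mul_ne_zero (fun h => ?_) (fun h => ?_)
    · rw [h, ENNReal.toReal_zero, zero_mul] at hk
      exact hk.false
    · rw [ENNReal.ofReal_eq_zero] at h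
      exact hk.not_ge (mul_nonpos_of_nonneg_of_nonpos ENNReal.toReal_nonneg h)
  have hpos' : ∑' j, markLaw p q (j, true) ≠ 0 := fun h => hpos (ENNReal.tsum_eq_zero.1 h k)
  have hmom : momentGen (fun j => markLaw p q (j, false)) 0 1 = ∑' j, markLaw p q (j, false) := by
    simp [momentGen]
  rw [hmom]
  conv_rhs => rw [← hsum]
  refine ENNReal.lt_add_right (fun h => ?_) hpos'
  rw [h, top_add] at hsum
  exact ENNReal.top_ne_one hsum

theorem momentGen_markLaw_ne_top {ℓ : ℕ}
    (hmoment : Summable fun k : ℕ => (k : ℝ) ^ ℓ * (p k).toReal) :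
    momentGen (fun j => markLaw p q (j, false)) ℓ 1 ≠ ⊤ := by
  refine ne_top_of_le_ne_top hmoment.tsum_ofReal_ne_top (ENNReal.tsum_le_tsum fun j => ?_)
  rw [one_pow, mul_one, ENNReal.ofReal_mul (by positivity), ENNReal.ofReal_pow (by positivity),
    ENNReal.ofReal_natCast, ENNReal.ofReal_toReal (PMF.apply_ne_top _ _), mul_comm]
  gcongr
  exact markLaw_false_le p q j

end MarkLaw

/-! ### The limit martingale and the Dirac mass -/

section LimitDensity

/-- Both cases of the definition have the same exponent, the number of nodes of the regular tree
below level `n`; it equals `n` when `r = 1`. -/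
theorem limitDensity_eq {r : ℕ} (n : ℕ) (a : ℝ) (T : MarkedTree) :
    limitDensity r a n T = (a ^ ∑ i ∈ Finset.range n, r ^ i)⁻¹ *
      (if T.M n = 0 ∧ T.Z n = r ^ n then 1 else 0) := by
  rw [limitDensity]
  by_cases hr : r = 1
  · rw [if_pos hr]
    subst hr
    simp only [one_pow, Finset.sum_const, Finset.card_range, smul_eq_mul, mul_one]
  · have hr' : (r : ℝ) ≠ 1 := by exact_mod_cast hr
    have he : ((r : ℝ) ^ n - 1) / ((r : ℝ) - 1) = ((∑ i ∈ Finset.range n, r ^ i : ℕ) : ℝ) := by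
      rw [← geom_sum_eq hr']
      push_cast
      rfl
    rw [if_neg hr, he, ← Int.cast_natCast (∑ i ∈ Finset.range n, r ^ i), ← Int.cast_neg,
      Real.rpow_intCast, zpow_neg, zpow_natCast]

theorem measurable_limitDensity (r : ℕ) (a : ℝ) (n : ℕ) :
    Measurable[filtration n] (limitDensity r a n) := by
  refine measurable_of_restrict fun T => ?_
  simp only [limitDensity, M_restrict, Z_restrict]

theorem limitDensity_nonneg {r : ℕ} {a : ℝ} (ha : 0 ≤ a) (n : ℕ) (T : MarkedTree) :
    0 ≤ limitDensity r a n T := by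
  rw [limitDensity_eq]
  positivity

theorem limitDensity_zero (r : ℕ) (a : ℝ) (T : MarkedTree) : limitDensity r a 0 T = 1 := by
  rw [limitDensity_eq]
  simp [M_zero, Z_zero]

theorem mem_iff_of_restrict_eq {n : ℕ} {Λ : Set MarkedTree} (hΛ : MeasurableSet[filtration n] Λ)
    {S T : MarkedTree} (h : S.restrict n = T.restrict n) : S ∈ Λ ↔ T ∈ Λ := by
  obtain ⟨A, -, rfl⟩ := hΛ
  simp [h]

open Classical in
/-- The limit density turns the law of the marked Galton-Watson tree into the Dirac mass at the
regular tree. -/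
theorem setLIntegral_limitDensity {p₀ : PMF (ℕ × Bool)} {r : ℕ} (hr : 1 ≤ r)
    (hc : ∀ j < r, p₀ (j, false) = 0) (hcr : p₀ (r, false) ≠ 0) (n : ℕ) {Λ : Set MarkedTree}
    (hΛ : MeasurableSet[filtration n] Λ) :
    ∫⁻ T in Λ, ENNReal.ofReal (limitDensity r (p₀ (r, false)).toReal n T) ∂mgwLaw p₀ =
      Measure.dirac (regular r) Λ := by
  have hΛ' : MeasurableSet Λ := filtration.le n _ hΛ
  set ρ := p₀ (r, false) ^ ∑ i ∈ Finset.range n, r ^ i with hρ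
  have hρ0 : ρ ≠ 0 := pow_ne_zero _ hcr
  have hρt : ρ ≠ ⊤ := ENNReal.pow_ne_top (PMF.apply_ne_top _ _)
  set R := restrict n ⁻¹' {(regular r).restrict n} with hR
  have hRm : MeasurableSet R := measurableSet_fiber _ _
  -- Almost surely, the event in the density is the regular fiber `R`, whose probability is `ρ`.
  have hae : ∀ᵐ T ∂(mgwLaw p₀).restrict Λ,
      ENNReal.ofReal (limitDensity r (p₀ (r, false)).toReal n T) =
        R.indicator (fun _ => ρ⁻¹) T := by
    refine ae_restrict_of_ae ?_
    filter_upwards [ae_restrict_eq_regular p₀ hr hc n] with T hT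
    have hiff : (T.M n = 0 ∧ T.Z n = r ^ n) ↔ T ∈ R :=
      ⟨fun h => hT h.1 h.2.le, fun h => ⟨(M_eq_of_restrict_eq h).trans (M_regular r n),
        (Z_eq_of_restrict_eq h).trans (Z_regular r n)⟩⟩
    rw [limitDensity_eq, Set.indicator_apply]
    simp only [hiff]
    split_ifs
    · rw [mul_one, ENNReal.ofReal_inv_of_pos, ENNReal.ofReal_pow ENNReal.toReal_nonneg,
        ENNReal.ofReal_toReal (PMF.apply_ne_top _ _)]
      exact pow_pos (ENNReal.toReal_pos hcr (PMF.apply_ne_top _ _)) _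
    · simp
  rw [lintegral_congr_ae hae, lintegral_indicator_const hRm, Measure.restrict_apply hRm,
    Measure.dirac_apply' _ hΛ', Set.indicator_apply]
  split_ifs with hmem
  -- The fiber is an atom of ℱ_n: `Λ` contains it or is disjoint from it.
  · have : R ∩ Λ = R := Set.inter_eq_left.2 fun T hT => (mem_iff_of_restrict_eq hΛ hT).2 hmem
    rw [this, hR, mgwLaw_regular_fiber, ENNReal.inv_mul_cancel hρ0 hρt]
    rfl
  · have : R ∩ Λ = ∅ := Set.eq_empty_of_forall_notMem fun T hT =>
      hmem ((mem_iff_of_restrict_eq hΛ hT.1).1 hT.2)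
    rw [this, measure_empty, mul_zero]

theorem integrable_limitDensity {p₀ : PMF (ℕ × Bool)} {r : ℕ} (hr : 1 ≤ r)
    (hc : ∀ j < r, p₀ (j, false) = 0) (hcr : p₀ (r, false) ≠ 0) (n : ℕ) :
    Integrable (limitDensity r (p₀ (r, false)).toReal n) (mgwLaw p₀) := by
  have hm := (measurable_limitDensity r (p₀ (r, false)).toReal n).mono (filtration.le n) le_rfl
  rw [← lintegral_ofReal_ne_top_iff_integrable hm.aestronglyMeasurable
    (.of_forall fun T => limitDensity_nonneg ENNReal.toReal_nonneg n T)]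
  have := setLIntegral_limitDensity hr hc hcr n (Λ := Set.univ) MeasurableSet.univ
  rw [Measure.restrict_univ] at this
  rw [this]
  exact measure_ne_top _ _

theorem setIntegral_limitDensity {p₀ : PMF (ℕ × Bool)} {r : ℕ} (hr : 1 ≤ r)
    (hc : ∀ j < r, p₀ (j, false) = 0) (hcr : p₀ (r, false) ≠ 0) (n : ℕ) {Λ : Set MarkedTree}
    (hΛ : MeasurableSet[filtration n] Λ) :
    ∫ T in Λ, limitDensity r (p₀ (r, false)).toReal n T ∂mgwLaw p₀ =
      (Measure.dirac (regular r)).real Λ := by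
  have hm := (measurable_limitDensity r (p₀ (r, false)).toReal n).mono (filtration.le n) le_rfl
  rw [integral_eq_lintegral_of_nonneg_ae
    (.of_forall fun T => limitDensity_nonneg ENNReal.toReal_nonneg n T) hm.aestronglyMeasurable,
    setLIntegral_limitDensity hr hc hcr n hΛ]
  rfl

/-- The integral over an event of ℱ_n is its Dirac mass at the regular tree, which does not depend
on the later index. -/
theorem martingale_limitDensity {p₀ : PMF (ℕ × Bool)} {r : ℕ} (hr : 1 ≤ r)
    (hc : ∀ j < r, p₀ (j, false) = 0) (hcr : p₀ (r, false) ≠ 0) :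
    Martingale (limitDensity r (p₀ (r, false)).toReal) filtration (mgwLaw p₀) := by
  have := (isMGWLaw_mgwLaw p₀).isProbabilityMeasure
  refine martingale_of_setIntegral_eq_succ
    (fun n => (measurable_limitDensity _ _ n).stronglyMeasurable)
    (integrable_limitDensity hr hc hcr) fun n Λ hΛ => ?_
  rw [setIntegral_limitDensity hr hc hcr n hΛ,
    setIntegral_limitDensity hr hc hcr (n + 1) (filtration.mono (Nat.le_succ n) _ hΛ)]

/-- A measure on marked trees is determined by its restrictions to the `ℱ_n`, if it is finite. -/
theorem measure_ext_of_filtration {Q Q' : Measure MarkedTree} [IsFiniteMeasure Q]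
    (h : ∀ (n : ℕ) (Λ : Set MarkedTree), MeasurableSet[filtration n] Λ → Q Λ = Q' Λ) : Q = Q' := by
  refine ext_of_generate_finite (⋃ n, {s | MeasurableSet[sigmaAlgebra n] s})
    (MeasurableSpace.generateFrom_iUnion_measurableSet sigmaAlgebra).symm
    (isPiSystem_iUnion_of_monotone _
      (fun n => @MeasurableSpace.isPiSystem_measurableSet _ (sigmaAlgebra n))
      (fun m n h s hs => filtration.mono h s hs)) ?_ (h 0 _ MeasurableSet.univ)
  intro s hs
  obtain ⟨n, hn⟩ := Set.mem_iUnion.1 hs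
  exact h n s hn

theorem forall_eq_setLIntegral_limitDensity_iff {p₀ : PMF (ℕ × Bool)} {r : ℕ} (hr : 1 ≤ r)
    (hc : ∀ j < r, p₀ (j, false) = 0) (hcr : p₀ (r, false) ≠ 0) (Q : Measure MarkedTree) :
    (∀ (n : ℕ) (Λ : Set MarkedTree), MeasurableSet[filtration n] Λ →
      Q Λ = ∫⁻ T in Λ, ENNReal.ofReal (limitDensity r (p₀ (r, false)).toReal n T) ∂mgwLaw p₀) ↔
    Q = Measure.dirac (regular r) := by
  constructor
  · intro h
    refine (measure_ext_of_filtration fun n Λ hΛ => ?_).symm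
    rw [h n Λ hΛ, setLIntegral_limitDensity hr hc hcr n hΛ]
  · rintro rfl n Λ hΛ
    rw [setLIntegral_limitDensity hr hc hcr n hΛ]

end LimitDensity

/-! ### The penalization limit -/

section Penalty

theorem hilbertPoly_natCast (ℓ z : ℕ) : hilbertPoly ℓ z = (z.choose ℓ : ℝ) := by
  rw [hilbertPoly, ← descPochhammer_eval_eq_prod_range, descPochhammer_eval_eq_descFactorial,
    Nat.descFactorial_eq_factorial_mul_choose]
  push_cast
  field_simp

theorem ofReal_penalty (ℓ : ℕ) {t : ℝ} (ht : 0 ≤ t) (m : ℕ) (T : MarkedTree) :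
    ENNReal.ofReal (penalty ℓ t m T) = {T : MarkedTree | T.M m = 0}.indicator
      (fun T => ((T.Z m).choose ℓ : ℝ≥0∞) * ENNReal.ofReal t ^ T.Z m) T := by
  rw [penalty, hilbertPoly_natCast]
  simp only [Set.indicator_apply, Set.mem_ofPred_eq]
  by_cases h : T.M m = 0
  · rw [if_pos h, if_pos h, mul_one, ENNReal.ofReal_mul (by positivity), ENNReal.ofReal_natCast,
      ENNReal.ofReal_pow ht]
  · rw [if_neg h, if_neg h]
    simp

theorem penalty_nonneg (ℓ : ℕ) {t : ℝ} (ht : 0 ≤ t) (m : ℕ) (T : MarkedTree) :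
    0 ≤ penalty ℓ t m T := by
  rw [penalty, hilbertPoly_natCast]
  positivity

theorem measurable_penalty (ℓ : ℕ) (t : ℝ) (m : ℕ) : Measurable (penalty ℓ t m) := by
  refine (measurable_of_restrict (n := m) fun T => ?_).mono (filtration.le m) le_rfl
  simp only [penalty, M_restrict, Z_restrict]

theorem setIntegral_penalty (P : Measure MarkedTree) (ℓ : ℕ) {t : ℝ} (ht : 0 ≤ t) (m : ℕ)
    (Λ : Set MarkedTree) :
    ∫ T in Λ, penalty ℓ t m T ∂P = (∫⁻ T in Λ ∩ {T | T.M m = 0},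
      ((T.Z m).choose ℓ : ℝ≥0∞) * ENNReal.ofReal t ^ T.Z m ∂P).toReal := by
  rw [integral_eq_lintegral_of_nonneg_ae (.of_forall fun T => penalty_nonneg ℓ ht m T)
    (measurable_penalty ℓ t m).aestronglyMeasurable]
  simp only [ofReal_penalty ℓ ht m]
  rw [setLIntegral_indicator (measurableSet_M_eq_zero m), Set.inter_comm]

variable {p₀ : PMF (ℕ × Bool)} {r : ℕ}

/-- Events that do not contain the regular tree are asymptotically negligible for the penalized
law. -/
theorem tendsto_penalized_zero (hr : 1 ≤ r) (hc : ∀ j < r, p₀ (j, false) = 0)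
    (hcr : p₀ (r, false) ≠ 0) (hδ : momentGen (fun j => p₀ (j, false)) 0 1 < 1) {ℓ : ℕ}
    (hA : momentGen (fun j => p₀ (j, false)) ℓ 1 ≠ ⊤) {s : ℝ≥0∞} (hs : s ≤ 1) (hs0 : s ≠ 0)
    (h2 : r = 1 → 2 ≤ ℓ → ∃ j, 2 ≤ j ∧ p₀ (j, false) ≠ 0) (n : ℕ) :
    (∀ᶠ m in atTop, ∫⁻ T in {T | T.M (n + m) = 0},
      ((T.Z (n + m)).choose ℓ : ℝ≥0∞) * s ^ T.Z (n + m) ∂mgwLaw p₀ ≠ 0) ∧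
    ∀ Λ : Set MarkedTree, MeasurableSet[filtration n] Λ → regular r ∉ Λ →
      Tendsto (fun m =>
        (∫⁻ T in Λ ∩ {T | T.M (n + m) = 0},
          ((T.Z (n + m)).choose ℓ : ℝ≥0∞) * s ^ T.Z (n + m) ∂mgwLaw p₀) /
        ∫⁻ T in {T | T.M (n + m) = 0},
          ((T.Z (n + m)).choose ℓ : ℝ≥0∞) * s ^ T.Z (n + m) ∂mgwLaw p₀) atTop (𝓝 0) := by
  set c : ℕ → ℝ≥0∞ := fun j => p₀ (j, false) with hcdef
  set g : ℕ → ℝ≥0∞ := fun z => (z.choose ℓ : ℝ≥0∞) * s ^ z with hg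
  obtain ⟨ε, hε, hev⟩ :=
    exists_tendsto_zero_branchOp_iterate_choose_le hr hc hcr hδ ℓ hA hs hs0 h2 n
  set ρ := p₀ (r, false) ^ ∑ i ∈ Finset.range n, r ^ i with hρ
  have hρ0 : ρ ≠ 0 := pow_ne_zero _ hcr
  -- The denominator is bounded below by the contribution of the regular fiber, which has mass `ρ`
  -- and on which `Z n` equals `r ^ n`.
  have hlow : ∀ m, (branchOp c)^[m] g (r ^ n) * ρ ≤
      ∫⁻ T in {T | T.M (n + m) = 0}, g (T.Z (n + m)) ∂mgwLaw p₀ := by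
    intro m
    have h := setLIntegral_add p₀ n m (Λ := Set.univ) MeasurableSet.univ g
    simp only [Set.univ_inter] at h
    have hsub : restrict n ⁻¹' {(regular r).restrict n} ⊆ {T | T.M n = 0} :=
      fun T hT => (M_eq_of_restrict_eq hT).trans (M_regular r n)
    rw [h]
    refine le_trans (le_of_eq ?_) (lintegral_mono_set hsub)
    rw [hρ, ← mgwLaw_regular_fiber, ← setLIntegral_const]
    refine setLIntegral_congr_fun (measurableSet_fiber _ _) fun T hT => ?_
    rw [Z_eq_of_restrict_eq hT, Z_regular]
  refine ⟨?_, fun Λ hΛ hmem => ?_⟩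
  · filter_upwards [hev] with m hm h0
    have := hlow m
    rw [h0] at this
    exact mul_ne_zero hm.1 hρ0 (le_antisymm this zero_le)
  set B := ∫⁻ T in {T | T.M n = 0}, (T.Z n : ℝ≥0∞) ^ ℓ ∂mgwLaw p₀ with hB
  have hBt : B ≠ ⊤ := by
    rw [hB, lintegral_eq_branchOp_iterate p₀ n fun z => (z : ℝ≥0∞) ^ ℓ]
    exact branchOp_iterate_natPow_ne_top ℓ (hc 0 hr) hδ.le hA n 1 one_ne_zero
  have hZ : Measurable fun T : MarkedTree => (T.Z n : ℝ≥0∞) ^ ℓ :=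
    (measurable_from_nat (f := fun z => (z : ℝ≥0∞) ^ ℓ)).comp (measurable_Z n)
  -- Almost surely, an unmarked tree of `Λ` has more than `r ^ n` nodes at level `n`, since
  -- otherwise it would lie in the regular fiber, which `Λ` misses.
  have hup : ∀ᶠ m in atTop, ∫⁻ T in Λ ∩ {T | T.M (n + m) = 0}, g (T.Z (n + m)) ∂mgwLaw p₀ ≤
      (branchOp c)^[m] g (r ^ n) * (ε m * B) := by
    filter_upwards [hev] with m hm
    rw [setLIntegral_add p₀ n m hΛ g]
    calc _ ≤ ∫⁻ T in Λ ∩ {T | T.M n = 0},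
          ε m * (branchOp c)^[m] g (r ^ n) * (T.Z n : ℝ≥0∞) ^ ℓ ∂mgwLaw p₀ := by
          refine setLIntegral_mono_ae' ((filtration.le n _ hΛ).inter (measurableSet_M_eq_zero n)) ?_
          filter_upwards [ae_restrict_eq_regular p₀ hr hc n] with T hT hTΛ
          refine hm.2 _ (not_le.1 fun hle => hmem ?_)
          exact (mem_iff_of_restrict_eq hΛ (hT hTΛ.2 hle)).1 hTΛ.1
      _ ≤ ∫⁻ T in {T | T.M n = 0},
          ε m * (branchOp c)^[m] g (r ^ n) * (T.Z n : ℝ≥0∞) ^ ℓ ∂mgwLaw p₀ :=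
          lintegral_mono_set Set.inter_subset_right
      _ = _ := by
          rw [lintegral_const_mul _ hZ]
          ring
  have hlim : Tendsto (fun m => ε m * B / ρ) atTop (𝓝 0) := by
    have := ENNReal.Tendsto.div_const (ENNReal.Tendsto.mul_const hε (Or.inr hBt)) (Or.inr hρ0)
    rwa [zero_mul, ENNReal.zero_div] at this
  refine tendsto_of_tendsto_of_tendsto_of_le_of_le' tendsto_const_nhds hlim
    (.of_forall fun _ => zero_le) ?_
  filter_upwards [hev, hup] with m hm hum
  refine (ENNReal.div_le_div hum (hlow m)).trans ?_
  rw [ENNReal.mul_div_mul_left _ _ hm.1]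
  -- Cancelling the common factor also requires it to be finite.
  refine ne_top_of_le_ne_top ?_ (branchOp_iterate_choose_le hr hc hcr hδ.le ℓ hs hs0 m (r ^ n)
    (pow_ne_zero _ (by omega)))
  exact ENNReal.mul_ne_top (ENNReal.pow_ne_top (ENNReal.natCast_ne_top _))
    (ENNReal.mul_ne_top (momentFactor_ne_top ℓ hcr hδ.le hA hs hs0 m) (ENNReal.pow_ne_top
      (ne_top_of_le_ne_top ENNReal.one_ne_top (momentGen_iterate_le_one hδ.le hs m))))

-- Either `Λ` or its complement misses the regular tree, and the penalized masses of the two add up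
-- to 1.
open Classical in
theorem tendsto_setIntegral_penalty_div (hr : 1 ≤ r) (hc : ∀ j < r, p₀ (j, false) = 0)
    (hcr : p₀ (r, false) ≠ 0) (hδ : momentGen (fun j => p₀ (j, false)) 0 1 < 1) {ℓ : ℕ}
    (hA : momentGen (fun j => p₀ (j, false)) ℓ 1 ≠ ⊤) {t : ℝ} (ht : t ∈ Set.Ioc (0 : ℝ) 1)
    (h2 : r = 1 → 2 ≤ ℓ → ∃ j, 2 ≤ j ∧ p₀ (j, false) ≠ 0) (n : ℕ) {Λ : Set MarkedTree}
    (hΛ : MeasurableSet[filtration n] Λ) :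
    (∀ᶠ m : ℕ in atTop, 0 < ∫ T, penalty ℓ t (n + m) T ∂mgwLaw p₀) ∧
    Tendsto (fun m : ℕ => (∫ T in Λ, penalty ℓ t (n + m) T ∂mgwLaw p₀) /
      ∫ T, penalty ℓ t (n + m) T ∂mgwLaw p₀) atTop (𝓝 ((Measure.dirac (regular r)).real Λ)) := by
  have hs : ENNReal.ofReal t ≤ 1 := ENNReal.ofReal_le_one.2 ht.2
  have hs0 : ENNReal.ofReal t ≠ 0 := (ENNReal.ofReal_pos.2 ht.1).ne'
  obtain ⟨hpos, hlim⟩ := tendsto_penalized_zero hr hc hcr hδ hA hs hs0 h2 n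
  have htop : ∀ m, ∫⁻ T in {T | T.M m = 0},
      ((T.Z m).choose ℓ : ℝ≥0∞) * ENNReal.ofReal t ^ T.Z m ∂mgwLaw p₀ ≠ ⊤ := by
    intro m
    rw [lintegral_eq_branchOp_iterate p₀ m fun z => (z.choose ℓ : ℝ≥0∞) * ENNReal.ofReal t ^ z]
    refine ne_top_of_le_ne_top
      (branchOp_iterate_natPow_ne_top ℓ (hc 0 hr) hδ.le hA m 1 one_ne_zero)
      (branchOp_iterate_mono _ _ fun z => ?_)
    refine (mul_le_of_le_one_right' (pow_le_one' hs _)).trans ?_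
    exact_mod_cast Nat.choose_le_pow z ℓ
  have huniv : ∀ m, ∫ T, penalty ℓ t m T ∂mgwLaw p₀ = (∫⁻ T in {T | T.M m = 0},
      ((T.Z m).choose ℓ : ℝ≥0∞) * ENNReal.ofReal t ^ T.Z m ∂mgwLaw p₀).toReal := by
    intro m
    rw [← setIntegral_univ, setIntegral_penalty _ _ ht.1.le, Set.univ_inter]
  have hpos' : ∀ᶠ m : ℕ in atTop, 0 < ∫ T, penalty ℓ t (n + m) T ∂mgwLaw p₀ := by
    filter_upwards [hpos] with m hm
    rw [huniv]
    exact ENNReal.toReal_pos hm (htop _)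
  have hzero : ∀ Λ : Set MarkedTree, MeasurableSet[filtration n] Λ → regular r ∉ Λ →
      Tendsto (fun m : ℕ => (∫ T in Λ, penalty ℓ t (n + m) T ∂mgwLaw p₀) /
        ∫ T, penalty ℓ t (n + m) T ∂mgwLaw p₀) atTop (𝓝 0) := by
    intro Λ hΛ hmem
    have := (ENNReal.tendsto_toReal ENNReal.zero_ne_top).comp (hlim Λ hΛ hmem)
    refine this.congr fun m => ?_
    rw [huniv, setIntegral_penalty _ _ ht.1.le, Function.comp_apply, ENNReal.toReal_div]
  refine ⟨hpos', ?_⟩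
  rw [Measure.real, Measure.dirac_apply' _ (filtration.le n _ hΛ), Set.indicator_apply]
  split_ifs with hmem
  · have h1 := (hzero Λᶜ hΛ.compl (fun h => h hmem)).const_sub 1
    rw [sub_zero] at h1
    rw [Pi.one_apply, ENNReal.toReal_one]
    refine h1.congr' ?_
    filter_upwards [hpos'] with m hm
    -- A non-integrable function would have integral 0, against positivity.
    have hint : Integrable (penalty ℓ t (n + m)) (mgwLaw p₀) := by
      by_contra hni
      rw [integral_undef hni] at hm
      exact hm.false
    rw [← integral_add_compl (filtration.le n _ hΛ) hint] at hm ⊢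
    field_simp
    ring
  · exact hzero Λ hΛ hmem

end Penalty

end MarkedGW

theorem mainTheorem8
    (p : PMF ℕ) (q : ℕ → unitInterval) (ℓ r : ℕ) (t : ℝ)
    -- nondegeneracy, finite mean and moment of order `ℓ` of the offspring law
    (hp : p 0 + p 1 < 1)
    (hmean : Summable fun k : ℕ => (k : ℝ) * (p k).toReal)
    (hmoment : Summable fun k : ℕ => (k : ℝ) ^ ℓ * (p k).toReal)
    -- a node is marked with positive probability
    (hq : ∃ k, 0 < (p k).toReal * (q k : ℝ))
    -- `r` is the least number of offspring of an unmarked node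
    (hr : IsLeast {j : ℕ | 0 < (p j).toReal * (1 - (q j : ℝ))} r)
    (hr1 : 1 ≤ r)
    (ht : t ∈ Set.Ioc (0 : ℝ) 1)
    -- the law of the marked Galton-Watson tree, and the number `𝐩₀(r, 0)`
    (P : Measure MarkedTree) (hP : P = mgwLaw (markLaw p q))
    (a : ℝ) (ha : a = (markLaw p q (r, false)).toReal) :
    -- the penalization limit; the premise excludes the case in which the normalization
    -- is identically zero
    ((r = 1 → 2 ≤ ℓ → ∃ j, 2 ≤ j ∧ 0 < (p j).toReal * (1 - (q j : ℝ))) →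
      ∀ (n : ℕ) (Λ : Set MarkedTree), MeasurableSet[MarkedTree.filtration n] Λ →
        (∀ᶠ m : ℕ in atTop, 0 < ∫ T, penalty ℓ t (n + m) T ∂P) ∧
        Tendsto
          (fun m : ℕ => (∫ T in Λ, penalty ℓ t (n + m) T ∂P) / (∫ T, penalty ℓ t (n + m) T ∂P))
          atTop (𝓝 (∫ T in Λ, limitDensity r a n T ∂P))) ∧
    -- the limit is a nonnegative martingale started at `1`
    Martingale (limitDensity r a) MarkedTree.filtration P ∧
    (∀ n T, 0 ≤ limitDensity r a n T) ∧
    (∀ T, limitDensity r a 0 T = 1) ∧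
    -- there is exactly one measure with these densities on the `ℱ_n`: the Dirac mass at the
    -- unmarked regular `r`-ary tree
    (∀ Q : Measure MarkedTree,
      (∀ (n : ℕ) (Λ : Set MarkedTree), MeasurableSet[MarkedTree.filtration n] Λ →
        Q Λ = ∫⁻ T in Λ, ENNReal.ofReal (limitDensity r a n T) ∂P) ↔
      Q = Measure.dirac (MarkedTree.regular r)) := by
  subst hP ha
  have hc : ∀ j < r, markLaw p q (j, false) = 0 := by
    intro j hj
    by_contra h
    exact hj.not_ge (hr.2 ((markLaw_false_ne_zero_iff p q j).1 h))
  have hcr : markLaw p q (r, false) ≠ 0 := (markLaw_false_ne_zero_iff p q r).2 hr.1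
  refine ⟨fun h2 n Λ hΛ => ?_, martingale_limitDensity hr1 hc hcr,
    limitDensity_nonneg ENNReal.toReal_nonneg, limitDensity_zero r _,
    forall_eq_setLIntegral_limitDensity_iff hr1 hc hcr⟩
  -- The announced limit is the Dirac mass of `Λ`.
  rw [setIntegral_limitDensity hr1 hc hcr n hΛ]
  refine tendsto_setIntegral_penalty_div hr1 hc hcr (momentGen_markLaw_lt_one p q hq)
    (momentGen_markLaw_ne_top p q hmoment) ht (fun h h' => ?_) n hΛ
  obtain ⟨j, hj, hpos⟩ := h2 h h'
  exact ⟨j, hj, (markLaw_false_ne_zero_iff p q j).2 hpos⟩
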